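/- **Setting.** Let $\mathbb H$ be a separable complex Hilbert space with inner product $\langle\cdot,\cdot\rangle$ linear in the first argument and with a fixed orthonormal basis $\{e_j\}$. Put $\overline{x}=\sum_j\overline{\langle x,e_j\rangle}e_j$, call $x$ real if $\overline x=x$, and let $(x\otimes y)(z)=\langle z,y\rangle x$. Write $\|A\|_{\rm tr}=\sum_j\langle (A^*A)^{1/2}e_j,e_j\rangle$ and $\|A\|_{\rm HS}=\|A^*A\|_{\rm tr}^{1/2}$, and let $\langle\cdot,\cdot\rangle_{\rm HS}$ be the Hilbert–Schmidt inner product. Let $|A|$ be the Lebesgue measure of $A\subset\mathbb R^d$, $d\ge 1$, and let $B(0,\delta)$ be the ball of radius $\delta$ about $0$. Let $X=\{X(t),\,t\in\mathbb R^d\}$ be a real (almost surely $X(t)=\overline{X(t)}$ for each $t$), mean-zero, second-order stationary $\mathbb H$-valued process: $\mathbb E\|X(t)\|^2<\infty$, and $\mathbb E[X(t)\otimes X(s)]$ and $\mathbb E[X(t)\otimes\overline{X(s)}]$ depend only on $t-s$. Put $C(h)=\mathbb E[X(h)\otimes X(0)]$. **Assumption C.** (a) $\int_{\mathbb R^d}\|C(h)\|_{\rm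 tr}\,dh<\infty$ (with $h\mapsto\|C(h)\|_{\rm tr}$ Lebesgue measurable). (b) For some $0<\gamma\le1$, $M<\infty$ and $\delta_0>0$, $$\int_{\mathbb R^d}\ \sup_{y:\|x-y\|\le\delta}\|C(y)-C(x)\|_{\rm tr}\,dx\le M\delta^\gamma\qquad\text{for all }0<\delta\le\delta_0 .$$ **Assumption K.** $K:\mathbb R^d\to[0,\infty)$ is continuous, $S_K=\{K>0\}$ is bounded, $\sup K=K(0)=1$, and $K$ is differentiable with bounded gradient in a neighbourhood of $0$. **Assumption S.** For each $n$ let $\mathbb T_n\subset\mathbb R^d$ be a finite set with convex hull $T_n$, let $V(t)=\{x\in T_n:\|x-t\|\le\|x-s\|\ \forall s\in\mathbb T_n\}$ $(t\in\mathbb T_n)$ be its Voronoi cells, and let $\delta_n=\max_{t\in\mathbb T_n}\sup_{x\in V(t)}\|x-t\|$. Then (a) $\delta_n\to0$ and $|T_n|\to\infty$; (b) $T_n/|T_n|^{1/d}$ converges in the Hausdorff metric to a fixed bounded convex set with non-empty interior. **Assumption V.** (a) $\mathbb E\|X(t)\|^4<\infty$ for all $t$. With $$\begin{aligned}{\rm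 cum}(Y_1,Y_2,Y_3,Y_4)={}&\mathbb E\langle Y_1\otimes Y_2,Y_3\otimes Y_4\rangle_{\rm HS}-\langle\mathbb E(Y_1\otimes Y_2),\mathbb E(Y_3\otimes Y_4)\rangle_{\rm HS}\\&-\mathbb E\langle Y_1,Y_3\rangle\,\mathbb E\langle Y_4,Y_2\rangle-\langle\mathbb E(Y_1\otimes\overline{Y_4}),\mathbb E(Y_3\otimes\overline{Y_2})\rangle_{\rm HS},\end{aligned}$$ (b) ${\rm cum}(X(t+\tau),X(s+\tau),X(w+\tau),X(v+\tau))={\rm cum}(X(t),X(s),X(w),X(v))$ for all $t,s,w,v,\tau$; (c) for some $\delta>0$, $$\sup_{w}\int\!\!\int\sup_{\lambda_1,\lambda_2,\lambda_3\in B(0,\delta)}\big|{\rm cum}(X(\lambda_1+u),X(\lambda_2+v),X(\lambda_3+w),X(0))\big|\,dv\,du<\infty .$$ **Estimator.** For bandwidths $\Delta_n>0$ let $$\hat f_n(\theta)=\frac1{(2\pi)^d}\sum_{t,s\in\mathbb T_n}e^{\mathrm i(t-s)^\top\theta}\,\frac{X(t)\otimes X(s)}{|T_n\cap(T_n-(t-s))|}\,K\!\Big(\frac{t-s}{\Delta_n}\Big)|V(t)|\,|V(s)|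 ,$$ where terms with $K((t-s)/\Delta_n)=0$ are $0$. **Theorem.** Let Assumptions C, K, S and V hold. Suppose that $\Delta_n S_K\subset T_n-T_n$ for all large $n$, that $\delta_n=\mathcal O(\Delta_n)$ (in particular this holds if $\Delta_n\to\infty$), and that $\Delta_n^d/|T_n|\to0$. Then for every set $\Theta\subset\mathbb R^d$ $$\sup_{\theta\in\Theta}\mathbb E\big\|\hat f_n(\theta)-\mathbb E\hat f_n(\theta)\big\|_{\rm HS}^2=\mathcal O\Big(\frac{\Delta_n^d}{|T_n|}\Big)\qquad(n\to\infty).$$ -/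

import Mathlib

open MeasureTheory Filter Topology
open scoped ENNReal Pointwise

namespace SpectralVar

section Operators

/-- The outer product `x ⊗ y : z ↦ ⟨z, y⟩ x`, where `⟨z, y⟩` is linear in `z`
(Mathlib's `inner ℂ y z`). -/
noncomputable def outer {H : Type*} [NormedAddCommGroup H] [InnerProductSpace ℂ H]
    (x y : H) : H →L[ℂ] H :=
  InnerProductSpace.rankOne ℂ x y

/-- Complex conjugation on `H` with respect to the designated real orthonormal basis `e`:
`∑ ⟨x, e j⟩ e j ↦ ∑ conj ⟨x, e j⟩ e j`. -/
noncomputable def conjH {H ι : Type*} [NormedAddCommGroup H] [InnerProductSpace ℂ H]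
    (e : HilbertBasis ι ℂ H) (x : H) : H :=
  e.repr.symm (star (e.repr x))

/-- The trace norm `∑ j, ⟨(A* A)^{1/2} e j, e j⟩`, with value `∞` if `A` is not trace class.
It does not depend on the orthonormal basis `e`. -/
noncomputable def traceNorm {H ι : Type*} [NormedAddCommGroup H] [InnerProductSpace ℂ H]
    [CompleteSpace H] (e : HilbertBasis ι ℂ H) (A : H →L[ℂ] H) : ℝ≥0∞ :=
  ∑' j, ENNReal.ofReal (inner ℂ (e j) (CFC.abs A (e j))).re

/-- The Hilbert-Schmidt norm `‖A* A‖_tr ^ (1/2)`, with value `∞` if `A` is not Hilbert-Schmidt. -/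
noncomputable def hsNorm {H ι : Type*} [NormedAddCommGroup H] [InnerProductSpace ℂ H]
    [CompleteSpace H] (e : HilbertBasis ι ℂ H) (A : H →L[ℂ] H) : ℝ≥0∞ :=
  traceNorm e (A.adjoint ∘L A) ^ (1 / 2 : ℝ)

/-- The Hilbert-Schmidt inner product `trace (A* B)`. -/
noncomputable def hsInner {H ι : Type*} [NormedAddCommGroup H] [InnerProductSpace ℂ H]
    [CompleteSpace H] (e : HilbertBasis ι ℂ H) (A B : H →L[ℂ] H) : ℂ :=
  ∑' j, inner ℂ (e j) ((A.adjoint ∘L B) (e j))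

end Operators

section RandomElements

/-- The cross-covariance operator `E (Y ⊗ Z)` of two square integrable mean-zero random elements. -/
noncomputable def crossCov {Ω H : Type*} [MeasurableSpace Ω] [NormedAddCommGroup H]
    [InnerProductSpace ℂ H] (P : Measure Ω) (Y Z : Ω → H) : H →L[ℂ] H :=
  ∫ ω, outer (Y ω) (Z ω) ∂P

/-- The fourth-order cumulant of mean-zero random elements of `H`.  All inner products are
conjugate-linear in the first argument; with the opposite convention the value is replaced by its
complex conjugate (for real random elements all terms are real). -/
noncomputable def cum {Ω H ι : Type*} [MeasurableSpace Ω] [NormedAddCommGroup H]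
    [InnerProductSpace ℂ H] [CompleteSpace H] (P : Measure Ω) (e : HilbertBasis ι ℂ H)
    (Y₁ Y₂ Y₃ Y₄ : Ω → H) : ℂ :=
  (∫ ω, hsInner e (outer (Y₁ ω) (Y₂ ω)) (outer (Y₃ ω) (Y₄ ω)) ∂P)
    - hsInner e (crossCov P Y₁ Y₂) (crossCov P Y₃ Y₄)
    - (∫ ω, inner ℂ (Y₁ ω) (Y₃ ω) ∂P) * (∫ ω, inner ℂ (Y₄ ω) (Y₂ ω) ∂P)
    - hsInner e (crossCov P Y₁ (fun ω => conjH e (Y₄ ω)))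
        (crossCov P Y₃ (fun ω => conjH e (Y₂ ω)))

/-- A process is real if it takes values in the real elements of `H`. -/
def IsRealProcess {Ω H ι : Type*} [MeasurableSpace Ω] [NormedAddCommGroup H]
    [InnerProductSpace ℂ H] {d : ℕ} (P : Measure Ω) (e : HilbertBasis ι ℂ H)
    (X : EuclideanSpace ℝ (Fin d) → Ω → H) : Prop :=
  ∀ t, ∀ᵐ ω ∂P, conjH e (X t ω) = X t ω

/-- A mean-zero, second-order stationary process: finite second moments, and both the covariance
operator and the pseudo-covariance operator depend only on the lag. -/
structure IsSecondOrderStationary {Ω H ι : Type*} [MeasurableSpace Ω] [NormedAddCommGroup H]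
    [InnerProductSpace ℂ H] {d : ℕ} (P : Measure Ω) (e : HilbertBasis ι ℂ H)
    (X : EuclideanSpace ℝ (Fin d) → Ω → H) : Prop where
  memLp_two : ∀ t, MemLp (X t) 2 P
  mean_zero : ∀ t, ∫ ω, X t ω ∂P = 0
  cov_shift : ∀ t s τ, crossCov P (X (t + τ)) (X (s + τ)) = crossCov P (X t) (X s)
  pseudoCov_shift : ∀ t s τ,
    crossCov P (X (t + τ)) (fun ω => conjH e (X (s + τ) ω)) =
      crossCov P (X t) (fun ω => conjH e (X s ω))

/-- The stationary covariance operator `C(h) = E (X(h) ⊗ X(0))`. -/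
noncomputable def statCov {Ω H : Type*} [MeasurableSpace Ω] [NormedAddCommGroup H]
    [InnerProductSpace ℂ H] {d : ℕ} (P : Measure Ω)
    (X : EuclideanSpace ℝ (Fin d) → Ω → H) (h : EuclideanSpace ℝ (Fin d)) : H →L[ℂ] H :=
  crossCov P (X h) (X 0)

/-- Conditions on an operator-valued covariance function: it is integrable in trace norm and
`L¹`-`γ`-Hölder for some `0 < γ ≤ 1`. -/
structure CovarianceCondition {H ι : Type*} [NormedAddCommGroup H] [InnerProductSpace ℂ H]
    [CompleteSpace H] {d : ℕ} (e : HilbertBasis ι ℂ H)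
    (C : EuclideanSpace ℝ (Fin d) → H →L[ℂ] H) : Prop where
  aemeasurable : AEMeasurable (fun h => traceNorm e (C h)) volume
  integrable : ∫⁻ h, traceNorm e (C h) < ∞
  holder : ∃ γ : ℝ, 0 < γ ∧ γ ≤ 1 ∧ ∃ M : ℝ, ∃ δ₀ > (0 : ℝ), ∀ δ : ℝ, 0 < δ → δ ≤ δ₀ →
    ∫⁻ x, (⨆ y, ⨆ (_ : ‖x - y‖ ≤ δ), traceNorm e (C y - C x)) ≤ ENNReal.ofReal (M * δ ^ γ)

/-- Fourth-order conditions on the process: finite fourth moments, stationarity of the fourth-order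
cumulants, and their integrability. -/
structure CumulantCondition {Ω H ι : Type*} [MeasurableSpace Ω] [NormedAddCommGroup H]
    [InnerProductSpace ℂ H] [CompleteSpace H] {d : ℕ} (P : Measure Ω) (e : HilbertBasis ι ℂ H)
    (X : EuclideanSpace ℝ (Fin d) → Ω → H) : Prop where
  memLp_four : ∀ t, MemLp (X t) 4 P
  cum_shift : ∀ t s w v τ,
    cum P e (X (t + τ)) (X (s + τ)) (X (w + τ)) (X (v + τ)) = cum P e (X t) (X s) (X w) (X v)
  cum_integrable : ∃ δ > (0 : ℝ),
    (⨆ w : EuclideanSpace ℝ (Fin d),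
      ∫⁻ u : EuclideanSpace ℝ (Fin d), ∫⁻ v : EuclideanSpace ℝ (Fin d),
        ⨆ l₁ ∈ Metric.ball (0 : EuclideanSpace ℝ (Fin d)) δ,
        ⨆ l₂ ∈ Metric.ball (0 : EuclideanSpace ℝ (Fin d)) δ,
        ⨆ l₃ ∈ Metric.ball (0 : EuclideanSpace ℝ (Fin d)) δ,
          ‖cum P e (X (l₁ + u)) (X (l₂ + v)) (X (l₃ + w)) (X 0)‖ₑ) < ∞

end RandomElements

section Sampling

/-- The sampling region: the (closed) convex hull of the finite set of sampling points. -/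
def region {d : ℕ} (𝕋 : Finset (EuclideanSpace ℝ (Fin d))) : Set (EuclideanSpace ℝ (Fin d)) :=
  convexHull ℝ (𝕋 : Set (EuclideanSpace ℝ (Fin d)))

/-- The Voronoi cell, within the sampling region, of the sampling point `t`. -/
def cell {d : ℕ} (𝕋 : Finset (EuclideanSpace ℝ (Fin d))) (t : EuclideanSpace ℝ (Fin d)) :
    Set (EuclideanSpace ℝ (Fin d)) :=
  {x | x ∈ region 𝕋 ∧ ∀ s ∈ 𝕋, dist x t ≤ dist x s}

/-- The diameter of the Voronoi tessellation: the largest distance from a sampling point to a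
point of its cell. -/
noncomputable def mesh {d : ℕ} (𝕋 : Finset (EuclideanSpace ℝ (Fin d))) : ℝ≥0∞ :=
  ⨆ t ∈ 𝕋, ⨆ x ∈ cell 𝕋 t, edist x t

/-- Mixed-domain sampling: the mesh tends to zero, the volume of the sampling region tends to
infinity, and the rescaled region converges in the Hausdorff metric to a bounded convex set with
non-empty interior. -/
structure SamplingCondition {d : ℕ} (𝕋 : ℕ → Finset (EuclideanSpace ℝ (Fin d))) : Prop where
  mesh_tendsto : Tendsto (fun n => mesh (𝕋 n)) atTop (𝓝 0)
  volume_tendsto : Tendsto (fun n => volume.real (region (𝕋 n))) atTop atTop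
  shape : ∃ T : Set (EuclideanSpace ℝ (Fin d)),
    Bornology.IsBounded T ∧ Convex ℝ T ∧ (interior T).Nonempty ∧
    Tendsto (fun n => Metric.hausdorffEDist
      (((volume.real (region (𝕋 n)) ^ (1 / (d : ℝ)))⁻¹ : ℝ) • region (𝕋 n)) T) atTop (𝓝 0)

/-- The set on which the kernel is positive. -/
def kernelSupport {d : ℕ} (K : EuclideanSpace ℝ (Fin d) → ℝ) : Set (EuclideanSpace ℝ (Fin d)) :=
  {u | 0 < K u}

/-- Conditions on the kernel. -/
structure KernelCondition {d : ℕ} (K : EuclideanSpace ℝ (Fin d) → ℝ) : Prop where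
  continuous : Continuous K
  nonneg : ∀ u, 0 ≤ K u
  support_bounded : Bornology.IsBounded (kernelSupport K)
  le_one : ∀ u, K u ≤ 1
  at_zero : K 0 = 1
  gradient_bounded : ∃ ε > (0 : ℝ), ∃ M : ℝ, ∀ u, ‖u‖ < ε →
    DifferentiableAt ℝ K u ∧ ‖gradient K u‖ ≤ M

/-- The spectral density estimator `f̂(θ)` based on the observations `X t`, `t ∈ 𝕋`, with kernel `K`
and bandwidth `Δ`.  The set `(fun x => x - h) '' T` is the translate `T - h`. -/
noncomputable def estimator {Ω H : Type*} [NormedAddCommGroup H] [InnerProductSpace ℂ H] {d : ℕ}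
    (X : EuclideanSpace ℝ (Fin d) → Ω → H) (K : EuclideanSpace ℝ (Fin d) → ℝ)
    (𝕋 : Finset (EuclideanSpace ℝ (Fin d))) (Δ : ℝ) (θ : EuclideanSpace ℝ (Fin d)) (ω : Ω) :
    H →L[ℂ] H :=
  ((1 / (2 * Real.pi) ^ d : ℝ) : ℂ) • ∑ t ∈ 𝕋, ∑ s ∈ 𝕋,
    (Complex.exp (Complex.I * ((inner ℝ (t - s) θ : ℝ) : ℂ)) *
      ((K (Δ⁻¹ • (t - s)) * volume.real (cell 𝕋 t) * volume.real (cell 𝕋 s) /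
        volume.real (region 𝕋 ∩ (fun x => x - (t - s)) '' region 𝕋) : ℝ) : ℂ)) •
      outer (X t ω) (X s ω)

/-- The variance `E ‖f̂(θ) - E f̂(θ)‖²_HS` of the estimator. -/
noncomputable def estimatorVariance {Ω H ι : Type*} [MeasurableSpace Ω] [NormedAddCommGroup H]
    [InnerProductSpace ℂ H] [CompleteSpace H] {d : ℕ} (P : Measure Ω) (e : HilbertBasis ι ℂ H)
    (X : EuclideanSpace ℝ (Fin d) → Ω → H) (K : EuclideanSpace ℝ (Fin d) → ℝ)
    (𝕋 : Finset (EuclideanSpace ℝ (Fin d))) (Δ : ℝ) (θ : EuclideanSpace ℝ (Fin d)) : ℝ≥0∞ :=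
  ∫⁻ ω, hsNorm e (estimator X K 𝕋 Δ θ ω - ∫ ω', estimator X K 𝕋 Δ θ ω' ∂P) ^ 2 ∂P

end Sampling

end SpectralVar

/-!
Expanding the square, `E ‖f̂(θ) - E f̂(θ)‖²_HS` is a quadratic form in the coefficients of `f̂(θ)`
whose entries are the Hilbert–Schmidt covariances of `X t ⊗ X s` and `X w ⊗ X v`. Each of them is a
fourth-order cumulant plus two products of second moments, and for a real stationary process the
latter are at most `‖C(w - t)‖_tr ‖C(s - v)‖_tr` and `‖C(t - v)‖_tr ‖C(w - s)‖_tr`.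

A coefficient is at most a constant times `|V(t)| |V(s)| / |T_n|`, because the overlap
`T_n ∩ (T_n - h)` has volume of order `|T_n|` for lags `h` of order `Δ_n = o(|T_n|^{1/d})`, and it
vanishes unless `‖t - s‖ ≤ R Δ_n`. For fixed `(w, v)` the sums over `(t, s)` are Riemann sums over
Voronoi cells. They are dominated by integrals of local suprema of the cumulant and of the
covariance, so they are bounded and contribute `O(1 / |T_n|)`. The remaining sum of the coefficients
over the pairs with `‖w - v‖ ≤ R Δ_n` is `O(Δ_n ^ d)`, since `δ_n = O(Δ_n)`.
-/

namespace SpectralVar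

theorem tsum_mul_sq_le_sq_mul_sq {α : Type*} (f g : α → ℝ≥0∞) :
    (∑' i, f i * g i) ^ 2 ≤ (∑' i, f i ^ 2) * ∑' i, g i ^ 2 := by
  have hsqrt : ∑' i, f i * g i ≤
      (∑' i, f i ^ 2) ^ (1 / 2 : ℝ) * (∑' i, g i ^ 2) ^ (1 / 2 : ℝ) := by
    rw [ENNReal.tsum_eq_iSup_sum]
    refine iSup_le fun s => (ENNReal.inner_le_Lp_mul_Lq s f g .two_two).trans ?_
    simp only [ENNReal.rpow_two]
    gcongr <;> exact ENNReal.sum_le_tsum s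
  have hsq (x : ℝ≥0∞) : (x ^ (1 / 2 : ℝ)) ^ 2 = x := by
    rw [← ENNReal.rpow_mul_natCast]; norm_num
  calc (∑' i, f i * g i) ^ 2
      ≤ ((∑' i, f i ^ 2) ^ (1 / 2 : ℝ) * (∑' i, g i ^ 2) ^ (1 / 2 : ℝ)) ^ 2 := by gcongr
    _ = (∑' i, f i ^ 2) * ∑' i, g i ^ 2 := by rw [mul_pow, hsq, hsq]

/-! ### Hilbert–Schmidt and trace norms -/

section HilbertSchmidt

variable {𝕜 E F G ι κ : Type*} [RCLike 𝕜]
  [NormedAddCommGroup E] [InnerProductSpace 𝕜 E]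
  [NormedAddCommGroup F] [InnerProductSpace 𝕜 F]
  [NormedAddCommGroup G] [InnerProductSpace 𝕜 G]

theorem enorm_inner_le (x y : E) : ‖inner 𝕜 x y‖ₑ ≤ ‖x‖ₑ * ‖y‖ₑ := by
  simpa only [enorm_eq_nnnorm] using mod_cast nnnorm_inner_le_nnnorm x y

theorem countable_of_hilbertBasis [TopologicalSpace.SeparableSpace E]
    (e : HilbertBasis ι 𝕜 E) : Countable ι := by
  have hdisj : Pairwise fun i j =>
      Disjoint (Metric.ball (e i) (1 / 2)) (Metric.ball (e j) (1 / 2)) := by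
    intro i j hij
    have hdist : ‖e i - e j‖ ^ 2 = 2 := by
      rw [@norm_sub_sq 𝕜, e.orthonormal.1 i, e.orthonormal.1 j, e.orthonormal.2 hij]
      norm_num
    apply Metric.ball_disjoint_ball
    rw [dist_eq_norm]
    nlinarith [norm_nonneg (e i - e j)]
  exact hdisj.countable_of_isOpen_disjoint (fun _ => Metric.isOpen_ball)
    fun i => ⟨e i, Metric.mem_ball_self (by norm_num)⟩

theorem tsum_enorm_inner_sq (e : HilbertBasis ι 𝕜 E) (x : E) :
    ∑' j, ‖inner 𝕜 (e j) x‖ₑ ^ 2 = ‖x‖ₑ ^ 2 := by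
  have hsum : HasSum (fun j => ‖inner 𝕜 (e j) x‖ ^ 2) (‖x‖ ^ 2) := by
    convert RCLike.hasSum_re 𝕜 (e.hasSum_inner_mul_inner x x) using 2 with j
    · rw [← inner_conj_symm x, RCLike.conj_mul, ← RCLike.ofReal_pow, RCLike.ofReal_re]
    · exact norm_sq_eq_re_inner x
  have h := ENNReal.ofReal_tsum_of_nonneg (fun j => sq_nonneg ‖inner 𝕜 (e j) x‖) hsum.summable
  rw [hsum.tsum_eq] at h
  simpa only [ENNReal.ofReal_pow (norm_nonneg _), ofReal_norm] using h.symm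

/-- The squared Hilbert–Schmidt norm `∑ j, ‖A (e j)‖²`, with value `∞` if `A` is not
Hilbert–Schmidt. It is easier to compute with than `hsNorm`; see `hsNorm_sq`. -/
noncomputable def hsSq (e : HilbertBasis ι 𝕜 E) (A : E →L[𝕜] F) : ℝ≥0∞ :=
  ∑' j, ‖A (e j)‖ₑ ^ 2

theorem hsSq_adjoint [CompleteSpace E] [CompleteSpace F] (e : HilbertBasis ι 𝕜 E)
    (f : HilbertBasis κ 𝕜 F) (A : E →L[𝕜] F) : hsSq f A.adjoint = hsSq e A := by
  simp_rw [hsSq, ← tsum_enorm_inner_sq e, ← tsum_enorm_inner_sq f]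
  rw [ENNReal.tsum_comm]
  congr! 5 with j i
  rw [ContinuousLinearMap.adjoint_inner_right, ← inner_conj_symm, RCLike.enorm_conj]

theorem enorm_apply_sq_le_hsSq_mul (e : HilbertBasis ι 𝕜 E) (A : E →L[𝕜] F) (x : E) :
    ‖A x‖ₑ ^ 2 ≤ hsSq e A * ‖x‖ₑ ^ 2 := by
  have hexp : ‖A x‖ₑ ≤ ∑' j, ‖A (e j)‖ₑ * ‖inner 𝕜 (e j) x‖ₑ := by
    have h := ((e.hasSum_repr x).mapL A).tsum_eq
    simp only [map_smul, e.repr_apply_apply] at h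
    rw [← h]
    refine enorm_tsum_le_tsum_enorm.trans_eq (tsum_congr fun j => ?_)
    rw [enorm_smul, mul_comm]
  calc ‖A x‖ₑ ^ 2 ≤ (∑' j, ‖A (e j)‖ₑ * ‖inner 𝕜 (e j) x‖ₑ) ^ 2 := by gcongr
    _ ≤ hsSq e A * ∑' j, ‖inner 𝕜 (e j) x‖ₑ ^ 2 := tsum_mul_sq_le_sq_mul_sq _ _
    _ = hsSq e A * ‖x‖ₑ ^ 2 := by rw [tsum_enorm_inner_sq]

theorem enorm_sq_le_hsSq (e : HilbertBasis ι 𝕜 E) (A : E →L[𝕜] F) : ‖A‖ₑ ^ 2 ≤ hsSq e A := by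
  obtain htop | hfin := eq_or_ne (hsSq e A) ∞
  · simp [htop]
  have hbound : ‖A‖ ≤ √(hsSq e A).toReal := by
    refine A.opNorm_le_bound (Real.sqrt_nonneg _) fun x => ?_
    refine le_of_sq_le_sq ?_ (by positivity)
    rw [mul_pow, Real.sq_sqrt ENNReal.toReal_nonneg]
    simpa using ENNReal.toReal_mono (by finiteness) (enorm_apply_sq_le_hsSq_mul e A x)
  rw [← ENNReal.ofReal_toReal hfin, ← ofReal_norm, ← ENNReal.ofReal_pow (norm_nonneg _)]
  exact ENNReal.ofReal_le_ofReal ((Real.le_sqrt (norm_nonneg _) ENNReal.toReal_nonneg).1 hbound)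

theorem hsSq_comp_le_hsSq_mul (e : HilbertBasis ι 𝕜 E) (f : HilbertBasis κ 𝕜 F)
    (A : F →L[𝕜] G) (B : E →L[𝕜] F) : hsSq e (A ∘L B) ≤ hsSq f A * hsSq e B := by
  rw [hsSq.eq_1 e B, ← ENNReal.tsum_mul_left]
  exact ENNReal.tsum_le_tsum fun j => enorm_apply_sq_le_hsSq_mul f A (B (e j))

theorem hsSq_comp_le_enorm_sq_mul (e : HilbertBasis ι 𝕜 E) (A : F →L[𝕜] G) (B : E →L[𝕜] F) :
    hsSq e (A ∘L B) ≤ ‖A‖ₑ ^ 2 * hsSq e B := by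
  rw [hsSq.eq_1 e B, ← ENNReal.tsum_mul_left]
  refine ENNReal.tsum_le_tsum fun j => ?_
  rw [← mul_pow]
  gcongr
  exact A.le_opENorm (B (e j))

theorem tsum_enorm_inner_sq_le (e : HilbertBasis ι 𝕜 E) (A B : E →L[𝕜] F) :
    (∑' j, ‖inner 𝕜 (A (e j)) (B (e j))‖ₑ) ^ 2 ≤ hsSq e A * hsSq e B := by
  refine le_trans ?_ (tsum_mul_sq_le_sq_mul_sq _ _)
  gcongr
  exact enorm_inner_le _ _

/-- Douglas' factorization lemma: `U` extends `B x ↦ A x` continuously to the closure of the range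
of `B` and vanishes on its orthogonal complement. -/
theorem exists_comp_eq_of_norm_apply_le [CompleteSpace F] [CompleteSpace G] {A : E →L[𝕜] G}
    {B : E →L[𝕜] F} (h : ∀ x, ‖A x‖ ≤ ‖B x‖) : ∃ U : F →L[𝕜] G, ‖U‖ ≤ 1 ∧ U ∘L B = A := by
  let M : Submodule 𝕜 F := B.range.topologicalClosure
  have : CompleteSpace M := B.range.isClosed_topologicalClosure.completeSpace_coe
  let B' : E →ₗ[𝕜] M := Submodule.inclusion B.range.le_topologicalClosure ∘ₗ B.rangeRestrict
  have hdense : DenseRange B' :=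
    ((denseRange_inclusion_iff subset_closure).2 subset_rfl).comp
      B.toLinearMap.surjective_rangeRestrict.denseRange (continuous_inclusion subset_closure)
  have hB' : ∀ x, ‖A.toLinearMap x‖ ≤ 1 * ‖B' x‖ := fun x => (h x).trans_eq (one_mul _).symm
  refine ⟨A.toLinearMap.extendOfNorm B' ∘L M.orthogonalProjectionOnto, ?_, ?_⟩
  · calc _ ≤ ‖A.toLinearMap.extendOfNorm B'‖ * ‖M.orthogonalProjectionOnto‖ :=
          ContinuousLinearMap.opNorm_comp_le _ _
      _ ≤ 1 * 1 := by
          gcongr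
          · exact LinearMap.opNorm_extendOfNorm_le hdense zero_le_one hB'
          · exact M.orthogonalProjectionOnto_norm_le
      _ = 1 := one_mul 1
  · ext x
    have hproj : M.orthogonalProjectionOnto (B x) = B' x :=
      M.orthogonalProjectionOnto_mem_subspace_eq_self (B' x)
    rw [ContinuousLinearMap.comp_apply, ContinuousLinearMap.comp_apply, hproj]
    exact LinearMap.extendOfNorm_eq hdense ⟨1, hB'⟩ x

end HilbertSchmidt

section TraceNorm

variable {H ι : Type*} [NormedAddCommGroup H] [InnerProductSpace ℂ H]

theorem outer_apply (x y z : H) : outer x y z = inner ℂ y z • x := rfl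

theorem norm_outer (x y : H) : ‖outer x y‖ = ‖x‖ * ‖y‖ :=
  InnerProductSpace.norm_rankOne x y

theorem continuous_outer : Continuous fun p : H × H => outer p.1 p.2 :=
  ((ContinuousLinearMap.smulRightL ℂ H H).continuous.comp
    ((innerSL ℂ).continuous.comp continuous_snd)).clm_apply continuous_fst

theorem hsSq_outer (e : HilbertBasis ι ℂ H) (x y : H) :
    hsSq e (outer x y) = ‖x‖ₑ ^ 2 * ‖y‖ₑ ^ 2 := by
  rw [← tsum_enorm_inner_sq e y, ← ENNReal.tsum_mul_left]
  refine tsum_congr fun j => ?_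
  rw [outer_apply, enorm_smul, mul_pow, mul_comm, ← inner_conj_symm y, RCLike.enorm_conj]

variable [CompleteSpace H] (e : HilbertBasis ι ℂ H)

theorem norm_abs_apply (A : H →L[ℂ] H) (x : H) : ‖CFC.abs A x‖ = ‖A x‖ := by
  have hsa : IsSelfAdjoint (CFC.abs A) := (CFC.abs_nonneg A).isSelfAdjoint
  have habs : (CFC.abs A).adjoint ∘L CFC.abs A = A.adjoint ∘L A := by
    rw [hsa.adjoint_eq]
    exact CFC.abs_mul_abs A
  rw [(CFC.abs A).apply_norm_eq_sqrt_inner_adjoint_right, habs,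
    ← A.apply_norm_eq_sqrt_inner_adjoint_right]

theorem tsum_ofReal_re_inner_adjoint_comp_self (A : H →L[ℂ] H) :
    ∑' j, ENNReal.ofReal (inner ℂ (e j) ((A.adjoint ∘L A) (e j))).re = hsSq e A := by
  refine tsum_congr fun j => ?_
  rw [← ofReal_norm, ← ENNReal.ofReal_pow (norm_nonneg _), A.apply_norm_sq_eq_inner_adjoint_right]
  rfl

theorem hsNorm_sq (A : H →L[ℂ] H) : hsNorm e A ^ 2 = hsSq e A := by
  have hnonneg : (0 : H →L[ℂ] H) ≤ A.adjoint ∘L A := star_mul_self_nonneg A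
  rw [hsNorm, ← ENNReal.rpow_mul_natCast, traceNorm, CFC.abs_of_nonneg _ hnonneg,
    tsum_ofReal_re_inner_adjoint_comp_self]
  norm_num

theorem exists_sqrt_abs (A : H →L[ℂ] H) :
    ∃ S : H →L[ℂ] H, IsSelfAdjoint S ∧ S ∘L S = CFC.abs A ∧ traceNorm e A = hsSq e S := by
  have hsa : IsSelfAdjoint (CFC.sqrt (CFC.abs A)) := (CFC.sqrt_nonneg _).isSelfAdjoint
  have hsq : CFC.sqrt (CFC.abs A) ∘L CFC.sqrt (CFC.abs A) = CFC.abs A :=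
    CFC.sqrt_mul_sqrt_self _ (CFC.abs_nonneg A)
  refine ⟨CFC.sqrt (CFC.abs A), hsa, hsq, ?_⟩
  rw [← tsum_ofReal_re_inner_adjoint_comp_self, hsa.adjoint_eq, hsq, traceNorm]

theorem hsSq_le_traceNorm_sq (A : H →L[ℂ] H) : hsSq e A ≤ traceNorm e A ^ 2 := by
  obtain ⟨S, -, hSS, htrace⟩ := exists_sqrt_abs e A
  calc hsSq e A = hsSq e (S ∘L S) := by
        rw [hSS]
        exact tsum_congr fun j => by rw [← ofReal_norm, ← ofReal_norm, norm_abs_apply]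
    _ ≤ hsSq e S * hsSq e S := hsSq_comp_le_hsSq_mul e e S S
    _ = traceNorm e A ^ 2 := by rw [htrace, sq]

/-- With `A = U |A|` and `S² = |A|`, the sum pairs `S (W U)†` with `S` in the Hilbert–Schmidt inner
product. -/
theorem tsum_enorm_inner_comp_le (W A : H →L[ℂ] H) :
    ∑' j, ‖inner ℂ (e j) (W (A (e j)))‖ₑ ≤ ‖W‖ₑ * traceNorm e A := by
  obtain ⟨S, hS, hSS, htrace⟩ := exists_sqrt_abs e A
  obtain ⟨U, hU, hUA⟩ := exists_comp_eq_of_norm_apply_le fun x => (norm_abs_apply A x).ge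
  let V := S ∘L (W ∘L U).adjoint
  have hV : hsSq e V ≤ ‖W‖ₑ ^ 2 * traceNorm e A := by
    calc hsSq e V = hsSq e ((W ∘L U) ∘L S) := by
          rw [← hsSq_adjoint e e, ContinuousLinearMap.adjoint_comp,
            ContinuousLinearMap.adjoint_adjoint, hS.adjoint_eq]
      _ ≤ ‖W ∘L U‖ₑ ^ 2 * hsSq e S := hsSq_comp_le_enorm_sq_mul e _ _
      _ ≤ ‖W‖ₑ ^ 2 * traceNorm e A := by
          rw [htrace]
          gcongr
          refine enorm_le_iff_norm_le.2 ((W.opNorm_comp_le U).trans ?_)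
          exact mul_le_of_le_one_right (norm_nonneg W) hU
  have hinner : ∀ j, inner ℂ (e j) (W (A (e j))) = inner ℂ (V (e j)) (S (e j)) := by
    intro j
    rw [ContinuousLinearMap.comp_apply, ← ContinuousLinearMap.adjoint_inner_right, hS.adjoint_eq,
      ContinuousLinearMap.adjoint_inner_left]
    have hA : U (S (S (e j))) = A (e j) := by
      rw [← ContinuousLinearMap.comp_apply S S, hSS, ← ContinuousLinearMap.comp_apply, hUA]
    rw [ContinuousLinearMap.comp_apply, hA]
  refine (ENNReal.pow_le_pow_left_iff two_ne_zero).1 ?_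
  calc (∑' j, ‖inner ℂ (e j) (W (A (e j)))‖ₑ) ^ 2
      = (∑' j, ‖inner ℂ (V (e j)) (S (e j))‖ₑ) ^ 2 := by simp only [hinner]
    _ ≤ hsSq e V * hsSq e S := tsum_enorm_inner_sq_le e V S
    _ ≤ ‖W‖ₑ ^ 2 * traceNorm e A * traceNorm e A := by gcongr; exact htrace.ge
    _ = (‖W‖ₑ * traceNorm e A) ^ 2 := by ring

theorem tsum_enorm_inner_comp_le_traceNorm {W : H →L[ℂ] H} (hW : ‖W‖ ≤ 1) (A : H →L[ℂ] H) :
    ∑' j, ‖inner ℂ (e j) (W (A (e j)))‖ₑ ≤ traceNorm e A := by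
  refine (tsum_enorm_inner_comp_le e W A).trans (mul_le_of_le_one_left' ?_)
  rw [← ofReal_norm]
  exact ENNReal.ofReal_le_one.2 hW

theorem traceNorm_add_le (A B : H →L[ℂ] H) :
    traceNorm e (A + B) ≤ traceNorm e A + traceNorm e B := by
  obtain ⟨W, hW, hWAB⟩ := exists_comp_eq_of_norm_apply_le fun x => (norm_abs_apply (A + B) x).le
  calc traceNorm e (A + B)
      ≤ ∑' j, (‖inner ℂ (e j) (W (A (e j)))‖ₑ + ‖inner ℂ (e j) (W (B (e j)))‖ₑ) := by
        refine ENNReal.tsum_le_tsum fun j => ?_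
        rw [← hWAB, ContinuousLinearMap.comp_apply, add_apply, map_add,
          inner_add_right]
        refine le_trans ?_ (enorm_add_le _ _)
        rw [← ofReal_norm]
        exact ENNReal.ofReal_le_ofReal (Complex.re_le_norm _)
    _ ≤ traceNorm e A + traceNorm e B := by
        rw [ENNReal.tsum_add]
        exact add_le_add (tsum_enorm_inner_comp_le_traceNorm e hW A)
          (tsum_enorm_inner_comp_le_traceNorm e hW B)

theorem hsInner_eq_tsum (A B : H →L[ℂ] H) :
    hsInner e A B = ∑' j, inner ℂ (A (e j)) (B (e j)) :=
  tsum_congr fun j => by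
    rw [ContinuousLinearMap.comp_apply, ContinuousLinearMap.adjoint_inner_right]

theorem enorm_hsInner_sq_le (A B : H →L[ℂ] H) :
    ‖hsInner e A B‖ₑ ^ 2 ≤ hsSq e A * hsSq e B := by
  rw [hsInner_eq_tsum]
  refine le_trans ?_ (tsum_enorm_inner_sq_le e A B)
  gcongr
  exact enorm_tsum_le_tsum_enorm

theorem hasSum_hsInner {A B : H →L[ℂ] H} (hA : hsSq e A < ∞) (hB : hsSq e B < ∞) :
    HasSum (fun j => inner ℂ (A (e j)) (B (e j))) (hsInner e A B) := by
  rw [hsInner_eq_tsum]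
  refine (Summable.of_enorm fun htop => ?_).hasSum
  have h := tsum_enorm_inner_sq_le e A B
  rw [htop] at h
  exact (ENNReal.mul_lt_top hA hB).not_ge (by simpa using h)

theorem enorm_hsInner_le_traceNorm_mul (A B : H →L[ℂ] H) :
    ‖hsInner e A B‖ₑ ≤ traceNorm e A * traceNorm e B := by
  refine (ENNReal.pow_le_pow_left_iff two_ne_zero).1 ((enorm_hsInner_sq_le e A B).trans ?_)
  rw [mul_pow]
  gcongr <;> exact hsSq_le_traceNorm_sq e _

end TraceNorm

theorem ennreal_mul_le_sq_add_sq (a b : ℝ≥0∞) : a * b ≤ a ^ 2 + b ^ 2 := by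
  rcases le_total a b with h | h
  · exact le_add_left ((mul_le_mul_left h b).trans_eq (sq b).symm)
  · exact le_add_right ((mul_le_mul_right h a).trans_eq (sq a).symm)

section Integration

variable {Ω E : Type*} [MeasurableSpace Ω] {P : Measure Ω} [NormedAddCommGroup E]

theorem hasSum_integral_of_lintegral_tsum_ne_top {ι : Type*} [Countable ι] [NormedSpace ℝ E]
    {F : ι → Ω → E} {f : Ω → E} (hF : ∀ i, AEStronglyMeasurable (F i) P)
    (hfin : ∫⁻ ω, ∑' i, ‖F i ω‖ₑ ∂P ≠ ∞) (hsum : ∀ᵐ ω ∂P, HasSum (fun i => F i ω) (f ω)) :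
    HasSum (fun i => ∫ ω, F i ω ∂P) (∫ ω, f ω ∂P) := by
  rw [lintegral_tsum fun i => (hF i).enorm] at hfin
  have hint : ∀ i, Integrable (F i) P := fun i =>
    ⟨hF i, (ENNReal.ne_top_of_tsum_ne_top hfin i).lt_top⟩
  have hnorm : Summable fun i => ∫ ω, ‖F i ω‖ ∂P := by
    simpa only [integral_norm_eq_lintegral_enorm (hF _)] using ENNReal.summable_toReal hfin
  rw [← integral_congr_ae (hsum.mono fun ω hω => hω.tsum_eq)]
  exact hasSum_integral_of_summable_integral_norm hint hnorm

theorem memLp_two_of_lintegral_enorm_sq_lt_top {f : Ω → E} (hf : AEStronglyMeasurable f P)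
    (hfin : ∫⁻ ω, ‖f ω‖ₑ ^ 2 ∂P < ∞) : MemLp f 2 P := by
  refine ⟨hf, (eLpNorm_lt_top_iff_lintegral_rpow_enorm_lt_top (by simp) (by simp)).2 ?_⟩
  simpa using hfin

theorem enorm_integral_sq_le [IsProbabilityMeasure P] [NormedSpace ℝ E] {f : Ω → E}
    (hf : AEStronglyMeasurable f P) : ‖∫ ω, f ω ∂P‖ₑ ^ 2 ≤ ∫⁻ ω, ‖f ω‖ₑ ^ 2 ∂P := by
  have hL1L2 := eLpNorm_le_eLpNorm_of_exponent_le (p := 1) (q := 2) (by norm_num) hf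
  rw [eLpNorm_one_eq_lintegral_enorm,
    eLpNorm_eq_lintegral_rpow_enorm_toReal (by simp) (by simp)] at hL1L2
  simpa [ENNReal.le_rpow_inv_iff] using (enorm_integral_le_lintegral_enorm f).trans hL1L2

end Integration

section VectorCovariance

variable {Ω H κ : Type*} [MeasurableSpace Ω] {P : Measure Ω} [NormedAddCommGroup H]
  [InnerProductSpace ℂ H] {Y Z : Ω → H}

theorem integrable_inner_of_memLp_two (hY : MemLp Y 2 P) (hZ : MemLp Z 2 P) :
    Integrable (fun ω => inner ℂ (Y ω) (Z ω)) P :=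
  (hY.norm.integrable_mul hZ.norm).mono' (hY.1.inner hZ.1)
    (.of_forall fun _ => norm_inner_le_norm _ _)

/-- The scalar covariance `E⟨Y - EY, Z - EZ⟩ = E⟨Y, Z⟩ - ⟨EY, EZ⟩` of two random elements of a
Hilbert space, taken in its uncentred form. -/
noncomputable def innerCov (P : Measure Ω) (Y Z : Ω → H) : ℂ :=
  (∫ ω, inner ℂ (Y ω) (Z ω) ∂P) - inner ℂ (∫ ω, Y ω ∂P) (∫ ω, Z ω ∂P)

theorem integral_inner_sub_integral [IsProbabilityMeasure P] [CompleteSpace H]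
    (hY : MemLp Y 2 P) (hZ : MemLp Z 2 P) :
    ∫ ω, inner ℂ (Y ω - ∫ ω', Y ω' ∂P) (Z ω - ∫ ω', Z ω' ∂P) ∂P = innerCov P Y Z := by
  have hY1 := hY.integrable one_le_two
  have hZ1 := hZ.integrable one_le_two
  have hYZ := integrable_inner_of_memLp_two hY hZ
  have hleft (c : H) : ∫ ω, inner ℂ (Y ω) c ∂P = inner ℂ (∫ ω, Y ω ∂P) c := by
    rw [← inner_conj_symm, ← integral_inner hY1, ← integral_conj]
    simp only [inner_conj_symm]
  have hright (c : H) : Integrable (fun ω => inner ℂ (Y ω) (Z ω) - inner ℂ (Y ω) c) P :=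
    hYZ.sub (hY1.inner_const c)
  have hmean (c c' : H) : Integrable (fun ω => inner ℂ c (Z ω) - inner ℂ c c') P :=
    (hZ1.const_inner c).sub (integrable_const _)
  simp_rw [inner_sub_left, inner_sub_right]
  rw [integral_sub (hright _) (hmean _ _), integral_sub hYZ (hY1.inner_const _),
    integral_sub (hZ1.const_inner _) (integrable_const _), hleft, integral_inner hZ1,
    integral_const, probReal_univ, one_smul, sub_self, sub_zero, innerCov]

theorem re_innerCov_self [IsProbabilityMeasure P] [CompleteSpace H] (hY : MemLp Y 2 P) :
    (innerCov P Y Y).re = ∫ ω, ‖Y ω - ∫ ω', Y ω' ∂P‖ ^ 2 ∂P := by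
  have hcen : MemLp (fun ω => Y ω - ∫ ω', Y ω' ∂P) 2 P := hY.sub (memLp_const _)
  rw [← integral_inner_sub_integral hY hY, ← RCLike.re_eq_complex_re,
    ← integral_re (integrable_inner_of_memLp_two hcen hcen)]
  simp_rw [norm_sq_eq_re_inner (𝕜 := ℂ)]

theorem innerCov_sum_smul [IsFiniteMeasure P] (s : Finset κ) (a : κ → ℂ) {Y : κ → Ω → H}
    (hY : ∀ p ∈ s, MemLp (Y p) 2 P) :
    innerCov P (fun ω => ∑ p ∈ s, a p • Y p ω) (fun ω => ∑ p ∈ s, a p • Y p ω) =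
      ∑ p ∈ s, ∑ q ∈ s, starRingEnd ℂ (a p) * a q * innerCov P (Y p) (Y q) := by
  have hmean : ∫ ω, ∑ p ∈ s, a p • Y p ω ∂P = ∑ p ∈ s, a p • ∫ ω, Y p ω ∂P := by
    rw [integral_finsetSum (f := fun p ω => a p • Y p ω) _
      fun p hp => ((hY p hp).integrable one_le_two).smul (a p)]
    simp only [integral_smul]
  have hexpand (x : κ → H) : inner ℂ (∑ p ∈ s, a p • x p) (∑ q ∈ s, a q • x q) =
      ∑ p ∈ s, ∑ q ∈ s, starRingEnd ℂ (a p) * a q * inner ℂ (x p) (x q) := by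
    simp_rw [sum_inner, inner_sum, inner_smul_left, inner_smul_right, mul_assoc]
  have hint : ∀ p ∈ s, ∀ q ∈ s, Integrable
      (fun ω => starRingEnd ℂ (a p) * a q * inner ℂ (Y p ω) (Y q ω)) P := fun p hp q hq =>
    (integrable_inner_of_memLp_two (hY p hp) (hY q hq)).const_mul _
  simp only [innerCov, hmean, hexpand, mul_sub, Finset.sum_sub_distrib]
  congr 1
  rw [integral_finsetSum _ fun p hp => integrable_finsetSum _ (hint p hp)]
  refine Finset.sum_congr rfl fun p hp => ?_
  rw [integral_finsetSum _ (hint p hp)]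
  simp only [integral_const_mul]

end VectorCovariance

section OperatorCovariance

variable {Ω H ι κ : Type*} [MeasurableSpace Ω] {P : Measure Ω} [NormedAddCommGroup H]
  [InnerProductSpace ℂ H] {e : HilbertBasis ι ℂ H} {A B : Ω → H →L[ℂ] H}

/-- A strongly measurable random operator with `E ‖A‖²_HS < ∞`, the Hilbert–Schmidt norm being
computed in the basis `e`. -/
structure IsHSSquareIntegrable (P : Measure Ω) (e : HilbertBasis ι ℂ H) (A : Ω → H →L[ℂ] H) :
    Prop where
  aestronglyMeasurable : AEStronglyMeasurable A P
  lintegral_hsSq_lt_top : ∫⁻ ω, hsSq e (A ω) ∂P < ∞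

namespace IsHSSquareIntegrable

theorem memLp_two (hA : IsHSSquareIntegrable P e A) : MemLp A 2 P :=
  memLp_two_of_lintegral_enorm_sq_lt_top hA.aestronglyMeasurable <|
    (lintegral_mono fun ω => enorm_sq_le_hsSq e (A ω)).trans_lt hA.lintegral_hsSq_lt_top

theorem integrable [IsFiniteMeasure P] (hA : IsHSSquareIntegrable P e A) : Integrable A P :=
  hA.memLp_two.integrable one_le_two

theorem memLp_two_apply (hA : IsHSSquareIntegrable P e A) (x : H) :
    MemLp (fun ω => A ω x) 2 P :=
  (ContinuousLinearMap.apply ℂ H x).comp_memLp' hA.memLp_two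

theorem aemeasurable_hsSq [Countable ι] (hA : IsHSSquareIntegrable P e A) :
    AEMeasurable (fun ω => hsSq e (A ω)) P :=
  AEMeasurable.tsum fun j => (hA.memLp_two_apply (e j)).1.enorm.pow_const 2

theorem hsSq_integral_lt_top [Countable ι] [IsProbabilityMeasure P]
    (hA : IsHSSquareIntegrable P e A) : hsSq e (∫ ω, A ω ∂P) < ∞ := by
  refine lt_of_le_of_lt ?_ hA.lintegral_hsSq_lt_top
  unfold hsSq
  rw [lintegral_tsum fun j => (hA.memLp_two_apply (e j)).1.enorm.pow_const 2]
  refine ENNReal.tsum_le_tsum fun j => ?_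
  rw [ContinuousLinearMap.integral_apply hA.integrable]
  exact enorm_integral_sq_le (hA.memLp_two_apply (e j)).1

theorem const_smul (hA : IsHSSquareIntegrable P e A) (c : ℂ) :
    IsHSSquareIntegrable P e (fun ω => c • A ω) where
  aestronglyMeasurable := hA.aestronglyMeasurable.const_smul c
  lintegral_hsSq_lt_top := by
    simp_rw [hsSq, smul_apply, enorm_smul, mul_pow, ENNReal.tsum_mul_left]
    rw [lintegral_const_mul' _ _ (by finiteness)]
    exact ENNReal.mul_lt_top (by finiteness) hA.lintegral_hsSq_lt_top

theorem add [Countable ι] (hA : IsHSSquareIntegrable P e A) (hB : IsHSSquareIntegrable P e B) :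
    IsHSSquareIntegrable P e (fun ω => A ω + B ω) where
  aestronglyMeasurable := hA.aestronglyMeasurable.add hB.aestronglyMeasurable
  lintegral_hsSq_lt_top := by
    have hadd (x y : H) : ‖x + y‖ₑ ^ 2 ≤ 2 * (‖x‖ₑ ^ 2 + ‖y‖ₑ ^ 2) := by
      calc ‖x + y‖ₑ ^ 2 ≤ (‖x‖ₑ + ‖y‖ₑ) ^ 2 := by gcongr; exact enorm_add_le x y
        _ ≤ 2 * (‖x‖ₑ ^ 2 + ‖y‖ₑ ^ 2) := by
          have h := ENNReal.rpow_add_le_mul_rpow_add_rpow ‖x‖ₑ ‖y‖ₑ one_le_two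
          norm_num at h
          exact h
    calc ∫⁻ ω, hsSq e (A ω + B ω) ∂P
        ≤ ∫⁻ ω, 2 * (hsSq e (A ω) + hsSq e (B ω)) ∂P := by
          refine lintegral_mono fun ω => ?_
          rw [hsSq, hsSq, hsSq, ← ENNReal.tsum_add, ← ENNReal.tsum_mul_left]
          exact ENNReal.tsum_le_tsum fun j => hadd _ _
      _ = 2 * (∫⁻ ω, hsSq e (A ω) ∂P + ∫⁻ ω, hsSq e (B ω) ∂P) := by
          rw [lintegral_const_mul' _ _ (by finiteness), lintegral_add_left' hA.aemeasurable_hsSq]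
      _ < ∞ := ENNReal.mul_lt_top (by finiteness)
          (ENNReal.add_lt_top.2 ⟨hA.lintegral_hsSq_lt_top, hB.lintegral_hsSq_lt_top⟩)

theorem sum [Countable ι] {s : Finset κ} {A : κ → Ω → H →L[ℂ] H}
    (hA : ∀ p ∈ s, IsHSSquareIntegrable P e (A p)) :
    IsHSSquareIntegrable P e (fun ω => ∑ p ∈ s, A p ω) := by
  classical
  induction s using Finset.induction_on with
  | empty => exact ⟨by simpa using aestronglyMeasurable_const, by simp [hsSq]⟩
  | insert p s hp ih =>
    simp only [Finset.sum_insert hp]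
    exact (hA p (Finset.mem_insert_self p s)).add
      (ih fun q hq => hA q (Finset.mem_insert_of_mem hq))

end IsHSSquareIntegrable

variable [CompleteSpace H]

/-- The covariance `E⟨A - EA, B - EB⟩_HS` of two random operators, taken in its uncentred form. -/
noncomputable def hsCov (P : Measure Ω) (e : HilbertBasis ι ℂ H) (A B : Ω → H →L[ℂ] H) : ℂ :=
  (∫ ω, hsInner e (A ω) (B ω) ∂P) - hsInner e (∫ ω, A ω ∂P) (∫ ω, B ω ∂P)

theorem hasSum_integral_hsInner [Countable ι] (hA : IsHSSquareIntegrable P e A)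
    (hB : IsHSSquareIntegrable P e B) :
    HasSum (fun j => ∫ ω, inner ℂ (A ω (e j)) (B ω (e j)) ∂P)
      (∫ ω, hsInner e (A ω) (B ω) ∂P) := by
  refine hasSum_integral_of_lintegral_tsum_ne_top
    (fun j => (hA.memLp_two_apply (e j)).1.inner (hB.memLp_two_apply (e j)).1) (ne_of_lt ?_) ?_
  · calc ∫⁻ ω, ∑' j, ‖inner ℂ (A ω (e j)) (B ω (e j))‖ₑ ∂P
        ≤ ∫⁻ ω, hsSq e (A ω) + hsSq e (B ω) ∂P := by
          refine lintegral_mono fun ω => ?_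
          rw [hsSq, hsSq, ← ENNReal.tsum_add]
          exact ENNReal.tsum_le_tsum fun j =>
            (enorm_inner_le _ _).trans (ennreal_mul_le_sq_add_sq _ _)
      _ < ∞ := by
          rw [lintegral_add_left' hA.aemeasurable_hsSq]
          exact ENNReal.add_lt_top.2 ⟨hA.lintegral_hsSq_lt_top, hB.lintegral_hsSq_lt_top⟩
  · filter_upwards [ae_lt_top' hA.aemeasurable_hsSq hA.lintegral_hsSq_lt_top.ne,
      ae_lt_top' hB.aemeasurable_hsSq hB.lintegral_hsSq_lt_top.ne] with ω hAω hBω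
    exact hasSum_hsInner e hAω hBω

theorem hasSum_innerCov_apply [Countable ι] [IsProbabilityMeasure P]
    (hA : IsHSSquareIntegrable P e A) (hB : IsHSSquareIntegrable P e B) :
    HasSum (fun j => innerCov P (fun ω => A ω (e j)) (fun ω => B ω (e j))) (hsCov P e A B) := by
  simp only [innerCov, ← ContinuousLinearMap.integral_apply hA.integrable,
    ← ContinuousLinearMap.integral_apply hB.integrable]
  exact (hasSum_integral_hsInner hA hB).sub
    (hasSum_hsInner e hA.hsSq_integral_lt_top hB.hsSq_integral_lt_top)

theorem lintegral_hsSq_sub_integral [Countable ι] [IsProbabilityMeasure P]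
    (hA : IsHSSquareIntegrable P e A) :
    ∫⁻ ω, hsSq e (A ω - ∫ ω', A ω' ∂P) ∂P = ENNReal.ofReal (hsCov P e A A).re := by
  set m := ∫ ω', A ω' ∂P
  have hcen (j : ι) : MemLp (fun ω => (A ω - m) (e j)) 2 P :=
    (hA.memLp_two_apply (e j)).sub (memLp_const (m (e j)))
  have hvar (j : ι) : (innerCov P (fun ω => A ω (e j)) (fun ω => A ω (e j))).re =
      ∫ ω, ‖(A ω - m) (e j)‖ ^ 2 ∂P := by
    rw [re_innerCov_self (hA.memLp_two_apply (e j)),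
      ← ContinuousLinearMap.integral_apply hA.integrable]
    rfl
  have hsum := Complex.hasSum_re (hasSum_innerCov_apply hA hA)
  rw [← hsum.tsum_eq, ENNReal.ofReal_tsum_of_nonneg _ hsum.summable]
  · unfold hsSq
    rw [lintegral_tsum fun j => (hcen j).1.enorm.pow_const 2]
    refine tsum_congr fun j => ?_
    rw [hvar, ofReal_integral_eq_lintegral_ofReal (hcen j).integrable_norm_pow'
      (.of_forall fun _ => by positivity)]
    simp_rw [ENNReal.ofReal_pow (norm_nonneg _), ofReal_norm]
  · intro j
    rw [hvar]
    positivity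

theorem hsCov_sum_smul [Countable ι] [IsProbabilityMeasure P] (s : Finset κ) (a : κ → ℂ)
    {A : κ → Ω → H →L[ℂ] H} (hA : ∀ p ∈ s, IsHSSquareIntegrable P e (A p)) :
    hsCov P e (fun ω => ∑ p ∈ s, a p • A p ω) (fun ω => ∑ p ∈ s, a p • A p ω) =
      ∑ p ∈ s, ∑ q ∈ s, starRingEnd ℂ (a p) * a q * hsCov P e (A p) (A q) := by
  have hsum : IsHSSquareIntegrable P e (fun ω => ∑ p ∈ s, a p • A p ω) :=
    .sum fun p hp => (hA p hp).const_smul (a p)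
  refine (hasSum_innerCov_apply hsum hsum).unique ?_
  simp only [sum_apply, smul_apply]
  simp_rw [innerCov_sum_smul s a fun p hp => (hA p hp).memLp_two_apply (e _)]
  exact hasSum_sum fun p hp => hasSum_sum fun q hq =>
    (hasSum_innerCov_apply (hA p hp) (hA q hq)).mul_left _

theorem lintegral_hsSq_sum_sub_integral_le [Countable ι] [IsProbabilityMeasure P] (s : Finset κ)
    (a : κ → ℂ) {A : κ → Ω → H →L[ℂ] H} (hA : ∀ p ∈ s, IsHSSquareIntegrable P e (A p)) :
    ∫⁻ ω, hsSq e ((∑ p ∈ s, a p • A p ω) - ∫ ω', ∑ p ∈ s, a p • A p ω' ∂P) ∂P ≤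
      ∑ p ∈ s, ∑ q ∈ s, ‖a p‖ₑ * ‖a q‖ₑ * ‖hsCov P e (A p) (A q)‖ₑ := by
  rw [lintegral_hsSq_sub_integral (.sum fun p hp => (hA p hp).const_smul (a p)),
    hsCov_sum_smul s a hA]
  calc _ ≤ ‖∑ p ∈ s, ∑ q ∈ s, starRingEnd ℂ (a p) * a q * hsCov P e (A p) (A q)‖ₑ := by
        rw [← ofReal_norm]
        exact ENNReal.ofReal_le_ofReal (Complex.re_le_norm _)
    _ ≤ ∑ p ∈ s, ∑ q ∈ s, ‖starRingEnd ℂ (a p) * a q * hsCov P e (A p) (A q)‖ₑ :=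
        (enorm_sum_le _ _).trans (Finset.sum_le_sum fun p _ => enorm_sum_le _ _)
    _ = ∑ p ∈ s, ∑ q ∈ s, ‖a p‖ₑ * ‖a q‖ₑ * ‖hsCov P e (A p) (A q)‖ₑ := by
        simp only [enorm_mul, RCLike.enorm_conj]

end OperatorCovariance

section RandomOuterProducts

variable {Ω H ι : Type*} [MeasurableSpace Ω] {P : Measure Ω} [NormedAddCommGroup H]
  [InnerProductSpace ℂ H] {Y Z : Ω → H}

theorem aestronglyMeasurable_outer (hY : AEStronglyMeasurable Y P)
    (hZ : AEStronglyMeasurable Z P) : AEStronglyMeasurable (fun ω => outer (Y ω) (Z ω)) P :=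
  Continuous.comp_aestronglyMeasurable (g := fun p : H × H => outer p.1 p.2)
    (f := fun ω => (Y ω, Z ω)) continuous_outer (hY.prodMk hZ)

theorem integrable_outer (hY : MemLp Y 2 P) (hZ : MemLp Z 2 P) :
    Integrable (fun ω => outer (Y ω) (Z ω)) P :=
  (hY.norm.integrable_mul hZ.norm).mono' (aestronglyMeasurable_outer hY.1 hZ.1)
    (.of_forall fun _ => (norm_outer _ _).le)

theorem isHSSquareIntegrable_outer (e : HilbertBasis ι ℂ H) (hY : MemLp Y 4 P)
    (hZ : MemLp Z 4 P) : IsHSSquareIntegrable P e (fun ω => outer (Y ω) (Z ω)) where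
  aestronglyMeasurable := aestronglyMeasurable_outer hY.1 hZ.1
  lintegral_hsSq_lt_top := by
    have hfourth {W : Ω → H} (hW : MemLp W 4 P) : ∫⁻ ω, (‖W ω‖ₑ ^ 2) ^ 2 ∂P < ∞ := by
      simpa [← pow_mul] using
        (eLpNorm_lt_top_iff_lintegral_rpow_enorm_lt_top (by norm_num) (by norm_num)).1 hW.2
    calc ∫⁻ ω, hsSq e (outer (Y ω) (Z ω)) ∂P
        ≤ ∫⁻ ω, (‖Y ω‖ₑ ^ 2) ^ 2 + (‖Z ω‖ₑ ^ 2) ^ 2 ∂P :=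
          lintegral_mono fun ω => (hsSq_outer e _ _).trans_le (ennreal_mul_le_sq_add_sq _ _)
      _ < ∞ := by
          rw [lintegral_add_left' ((hY.1.enorm.pow_const 2).pow_const 2)]
          exact ENNReal.add_lt_top.2 ⟨hfourth hY, hfourth hZ⟩

variable [CompleteSpace H]

theorem inner_crossCov_apply (hY : MemLp Y 2 P) (hZ : MemLp Z 2 P) (x y : H) :
    inner ℂ x (crossCov P Y Z y) = ∫ ω, inner ℂ (Z ω) y * inner ℂ x (Y ω) ∂P := by
  have hint := integrable_outer hY hZ
  rw [crossCov, ContinuousLinearMap.integral_apply hint,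
    ← integral_inner (hint.apply_continuousLinearMap y)]
  simp only [outer_apply, inner_smul_right]

/-- The left-hand side is the modulus of the trace of `crossCov P Y Z`. -/
theorem enorm_integral_inner_le_traceNorm [Countable ι] (e : HilbertBasis ι ℂ H)
    (hY : MemLp Y 2 P) (hZ : MemLp Z 2 P) :
    ‖∫ ω, inner ℂ (Z ω) (Y ω) ∂P‖ₑ ≤ traceNorm e (crossCov P Y Z) := by
  have hParseval (ω : Ω) :
      ∑' j, ‖inner ℂ (Z ω) (e j) * inner ℂ (e j) (Y ω)‖ₑ ≤ ‖Z ω‖ₑ * ‖Y ω‖ₑ := by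
    refine (ENNReal.pow_le_pow_left_iff two_ne_zero).1 ?_
    simp_rw [enorm_mul, mul_pow, ← tsum_enorm_inner_sq e, ← inner_conj_symm (Z ω),
      RCLike.enorm_conj]
    exact tsum_mul_sq_le_sq_mul_sq _ _
  have hsum : HasSum (fun j => ∫ ω, inner ℂ (Z ω) (e j) * inner ℂ (e j) (Y ω) ∂P)
      (∫ ω, inner ℂ (Z ω) (Y ω) ∂P) := by
    refine hasSum_integral_of_lintegral_tsum_ne_top
      (fun j => (hZ.1.inner aestronglyMeasurable_const).mul
        (aestronglyMeasurable_const.inner hY.1)) (ne_of_lt ?_)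
      (.of_forall fun ω => e.hasSum_inner_mul_inner _ _)
    refine (lintegral_mono hParseval).trans_lt ?_
    simpa [HasFiniteIntegral] using (hZ.norm.integrable_mul hY.norm).2
  calc ‖∫ ω, inner ℂ (Z ω) (Y ω) ∂P‖ₑ
      ≤ ∑' j, ‖∫ ω, inner ℂ (Z ω) (e j) * inner ℂ (e j) (Y ω) ∂P‖ₑ := by
        rw [← hsum.tsum_eq]
        exact enorm_tsum_le_tsum_enorm
    _ = ∑' j, ‖inner ℂ (e j) (ContinuousLinearMap.id ℂ H (crossCov P Y Z (e j)))‖ₑ := by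
        simp only [ContinuousLinearMap.id_apply, inner_crossCov_apply hY hZ]
    _ ≤ traceNorm e (crossCov P Y Z) :=
        tsum_enorm_inner_comp_le_traceNorm e ContinuousLinearMap.norm_id_le _

end RandomOuterProducts

section RandomFields

variable {Ω H ι : Type*} [MeasurableSpace Ω] {P : Measure Ω} [NormedAddCommGroup H]
  [InnerProductSpace ℂ H] {e : HilbertBasis ι ℂ H} {d : ℕ}
  {X : EuclideanSpace ℝ (Fin d) → Ω → H}

theorem IsSecondOrderStationary.crossCov_eq_statCov_sub (hX : IsSecondOrderStationary P e X)
    (t s : EuclideanSpace ℝ (Fin d)) : crossCov P (X t) (X s) = statCov P X (t - s) := by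
  simpa only [statCov, zero_add, sub_add_cancel] using hX.cov_shift (t - s) 0 s

theorem IsRealProcess.crossCov_conjH (hX : IsRealProcess P e X) (Y : Ω → H)
    (s : EuclideanSpace ℝ (Fin d)) :
    crossCov P Y (fun ω => conjH e (X s ω)) = crossCov P Y (X s) :=
  integral_congr_ae ((hX s).mono fun ω hω => by simp only [hω])

variable [CompleteSpace H]

/-- Reality of the process turns the pseudo-covariances in the cumulant into covariances. -/
theorem hsCov_outer_eq (hreal : IsRealProcess P e X) (hstat : IsSecondOrderStationary P e X)
    (t s w v : EuclideanSpace ℝ (Fin d)) :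
    hsCov P e (fun ω => outer (X t ω) (X s ω)) (fun ω => outer (X w ω) (X v ω)) =
      cum P e (X t) (X s) (X w) (X v) +
        (∫ ω, inner ℂ (X t ω) (X w ω) ∂P) * (∫ ω, inner ℂ (X v ω) (X s ω) ∂P) +
        hsInner e (statCov P X (t - v)) (statCov P X (w - s)) := by
  rw [cum, hreal.crossCov_conjH, hreal.crossCov_conjH, hstat.crossCov_eq_statCov_sub t v,
    hstat.crossCov_eq_statCov_sub w s, hsCov, crossCov, crossCov]
  ring

theorem enorm_hsCov_outer_le [Countable ι] (hreal : IsRealProcess P e X)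
    (hstat : IsSecondOrderStationary P e X) (t s w v : EuclideanSpace ℝ (Fin d)) :
    ‖hsCov P e (fun ω => outer (X t ω) (X s ω)) (fun ω => outer (X w ω) (X v ω))‖ₑ ≤
      ‖cum P e (X t) (X s) (X w) (X v)‖ₑ +
        traceNorm e (statCov P X (w - t)) * traceNorm e (statCov P X (s - v)) +
        traceNorm e (statCov P X (t - v)) * traceNorm e (statCov P X (w - s)) := by
  have htrace (p q : EuclideanSpace ℝ (Fin d)) :
      ‖∫ ω, inner ℂ (X p ω) (X q ω) ∂P‖ₑ ≤ traceNorm e (statCov P X (q - p)) := by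
    rw [← hstat.crossCov_eq_statCov_sub]
    exact enorm_integral_inner_le_traceNorm e (hstat.memLp_two q) (hstat.memLp_two p)
  rw [hsCov_outer_eq hreal hstat]
  refine enorm_add₃_le.trans ?_
  rw [enorm_mul]
  gcongr
  · exact htrace t w
  · exact htrace v s
  · exact enorm_hsInner_le_traceNorm_mul e _ _

end RandomFields

/-! ### Voronoi cells and overlaps of the sampling region -/

section Voronoi

variable {d : ℕ} (𝕋 : Finset (EuclideanSpace ℝ (Fin d)))

theorem isCompact_region : IsCompact (region 𝕋) :=
  𝕋.finite_toSet.isCompact_convexHull ℝ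

theorem convex_region : Convex ℝ (region 𝕋) := convex_convexHull ℝ _

theorem cell_subset_region (t : EuclideanSpace ℝ (Fin d)) : cell 𝕋 t ⊆ region 𝕋 :=
  fun _ hx => hx.1

theorem isClosed_cell (t : EuclideanSpace ℝ (Fin d)) : IsClosed (cell 𝕋 t) := by
  have hcell : cell 𝕋 t = region 𝕋 ∩ ⋂ s ∈ 𝕋, {x | dist x t ≤ dist x s} := by
    ext x
    simp [cell]
  rw [hcell]
  exact (isCompact_region 𝕋).isClosed.inter (isClosed_biInter fun s _ =>
    isClosed_le (continuous_id.dist continuous_const) (continuous_id.dist continuous_const))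

theorem aedisjoint_cell :
    (𝕋 : Set (EuclideanSpace ℝ (Fin d))).Pairwise
      (Function.onFun (AEDisjoint volume) (cell 𝕋)) := by
  intro t ht s hs hts
  refine measure_mono_null (t := (AffineSubspace.perpBisector t s : Set _)) ?_
    (Measure.addHaar_affineSubspace volume _ fun h => hts (AffineSubspace.perpBisector_eq_top.1 h))
  rintro x ⟨hxt, hxs⟩
  exact AffineSubspace.mem_perpBisector_iff_dist_eq.2 (le_antisymm (hxt.2 s hs) (hxs.2 t ht))

theorem volume_cell_ne_top (t : EuclideanSpace ℝ (Fin d)) : volume (cell 𝕋 t) ≠ ∞ :=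
  measure_ne_top_of_subset (cell_subset_region 𝕋 t) (isCompact_region 𝕋).measure_ne_top

theorem sum_volume_cell_mul_le_lintegral {g G : EuclideanSpace ℝ (Fin d) → ℝ≥0∞}
    (h : ∀ t ∈ 𝕋, ∀ x ∈ cell 𝕋 t, g t ≤ G x) :
    ∑ t ∈ 𝕋, volume (cell 𝕋 t) * g t ≤ ∫⁻ x, G x := by
  calc ∑ t ∈ 𝕋, volume (cell 𝕋 t) * g t ≤ ∑ t ∈ 𝕋, ∫⁻ x in cell 𝕋 t, G x := by
        refine Finset.sum_le_sum fun t ht => ?_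
        rw [mul_comm, ← setLIntegral_const]
        exact setLIntegral_mono' (isClosed_cell 𝕋 t).measurableSet (h t ht)
    _ = ∫⁻ x in ⋃ t ∈ 𝕋, cell 𝕋 t, G x :=
        (lintegral_biUnion_finset₀ (aedisjoint_cell 𝕋)
          (fun t _ => (isClosed_cell 𝕋 t).measurableSet.nullMeasurableSet) G).symm
    _ ≤ ∫⁻ x, G x := setLIntegral_le_lintegral _ _

theorem sum_volume_cell_le : ∑ t ∈ 𝕋, volume (cell 𝕋 t) ≤ volume (region 𝕋) := by
  have h := sum_volume_cell_mul_le_lintegral 𝕋 (g := 1) (G := (region 𝕋).indicator 1)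
    fun t _ x hx => by simp [cell_subset_region 𝕋 t hx]
  rw [lintegral_indicator_one (isCompact_region 𝕋).measurableSet] at h
  simpa using h

variable {𝕋}

theorem norm_sub_le_of_mem_cell {δ : ℝ} (hδ : 0 ≤ δ) (hmesh : mesh 𝕋 ≤ ENNReal.ofReal δ)
    {t x : EuclideanSpace ℝ (Fin d)} (ht : t ∈ 𝕋) (hx : x ∈ cell 𝕋 t) : ‖x - t‖ ≤ δ := by
  have hedist : edist x t ≤ mesh 𝕋 := by
    unfold mesh
    exact le_iSup₂_of_le t ht (le_iSup₂_of_le x hx le_rfl)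
  rw [← dist_eq_norm, ← ENNReal.ofReal_le_ofReal_iff hδ, ← edist_dist]
  exact hedist.trans hmesh

end Voronoi

section InnerBalls

theorem ball_sub_subset_inter_image_sub {E : Type*} [SeminormedAddCommGroup E] {S : Set E}
    {x : E} {r : ℝ} (hS : Metric.ball x r ⊆ S) (h : E) :
    Metric.ball x (r - ‖h‖) ⊆ S ∩ (fun y => y - h) '' S := by
  intro y hy
  rw [Metric.mem_ball, dist_eq_norm] at hy
  refine ⟨hS ?_, y + h, hS ?_, add_sub_cancel_right y h⟩ <;> rw [Metric.mem_ball, dist_eq_norm]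
  · linarith [norm_nonneg h]
  · rw [add_sub_right_comm]
    linarith [norm_add_le (y - x) h]

variable {E : Type*} [NormedAddCommGroup E] [InnerProductSpace ℝ E] {R : Set E}

theorem exists_norm_eq_one_forall_inner_sub_pos (hR : IsComplete R) (hconv : Convex ℝ R)
    (hne : R.Nonempty) {y : E} (hy : y ∉ R) :
    ∃ u : E, ‖u‖ = 1 ∧ ∀ q ∈ R, 0 < inner ℝ (y - q) u := by
  obtain ⟨p, hp, hproj⟩ := exists_norm_eq_iInf_of_complete_convex hne hR hconv y
  rw [norm_eq_iInf_iff_real_inner_le_zero hconv hp] at hproj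
  have hyp : 0 < ‖y - p‖ := norm_pos_iff.2 fun h => hy (by rwa [sub_eq_zero.1 h])
  refine ⟨‖y - p‖⁻¹ • (y - p), by rw [norm_smul, norm_inv, norm_norm, inv_mul_cancel₀ hyp.ne'],
    fun q hq => ?_⟩
  rw [real_inner_smul_right]
  refine mul_pos (inv_pos.2 hyp) ?_
  calc 0 < ‖y - p‖ ^ 2 - inner ℝ (y - p) (q - p) := by
        linarith [hproj q hq, pow_pos hyp 2]
    _ = inner ℝ (y - q) (y - p) := by
        rw [← real_inner_self_eq_norm_sq, ← inner_sub_right, sub_sub_sub_cancel_right,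
          real_inner_comm]

theorem ball_sub_subset_of_subset_thickening (hR : IsComplete R) (hconv : Convex ℝ R) {x : E}
    {r s : ℝ} (hs : 0 ≤ s) (hball : Metric.ball x r ⊆ Metric.thickening s R) :
    Metric.ball x (r - s) ⊆ R := by
  intro y hy
  by_contra hyR
  have hne : R.Nonempty := by
    obtain ⟨q, hq, -⟩ := Metric.mem_thickening_iff.1
      (hball (Metric.ball_subset_ball (by linarith) hy))
    exact ⟨q, hq⟩
  obtain ⟨u, hu, hsep⟩ := exists_norm_eq_one_forall_inner_sub_pos hR hconv hne hyR
  have hz : y + s • u ∈ Metric.ball x r := by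
    rw [Metric.mem_ball, dist_eq_norm] at hy ⊢
    have hsu : ‖s • u‖ = s := by rw [norm_smul, hu, mul_one, Real.norm_of_nonneg hs]
    rw [add_sub_right_comm]
    linarith [norm_add_le (y - x) (s • u)]
  obtain ⟨q, hq, hzq⟩ := Metric.mem_thickening_iff.1 (hball hz)
  have hinner : inner ℝ (y + s • u - q) u = inner ℝ (y - q) u + s := by
    rw [add_sub_right_comm, inner_add_left, real_inner_smul_left, real_inner_self_eq_norm_sq, hu,
      one_pow, mul_one]
  have hle := real_inner_le_norm (y + s • u - q) u
  rw [hinner, hu, mul_one, ← dist_eq_norm] at hle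
  linarith [hsep q hq]

end InnerBalls

section Overlap

variable {d : ℕ} {𝕋 : ℕ → Finset (EuclideanSpace ℝ (Fin d))}

theorem SamplingCondition.dim_ne_zero (hS : SamplingCondition 𝕋) : d ≠ 0 := by
  rintro rfl
  obtain ⟨n, hn⟩ := (hS.volume_tendsto.eventually_gt_atTop
    (volume.real (Set.univ : Set (EuclideanSpace ℝ (Fin 0))))).exists
  exact hn.not_ge (measureReal_mono (Set.subset_univ _) isCompact_univ.measure_ne_top)

theorem SamplingCondition.exists_ball_subset_region (hS : SamplingCondition 𝕋) :
    ∃ r > (0 : ℝ), ∀ᶠ n in atTop, ∃ x,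
      Metric.ball x (volume.real (region (𝕋 n)) ^ (1 / (d : ℝ)) * r) ⊆ region (𝕋 n) := by
  obtain ⟨T, -, -, ⟨x₀, hx₀⟩, hlim⟩ := hS.shape
  obtain ⟨r, hr, hball⟩ := Metric.isOpen_iff.1 isOpen_interior x₀ hx₀
  refine ⟨r - r / 2, by linarith, ?_⟩
  filter_upwards [hlim.eventually_lt_const (ENNReal.ofReal_pos.2 (half_pos hr)),
    hS.volume_tendsto.eventually_gt_atTop 0] with n hn hpos
  set a := volume.real (region (𝕋 n)) ^ (1 / (d : ℝ))
  have ha : 0 < a := by positivity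
  have hthick : Metric.ball x₀ r ⊆ Metric.thickening (r / 2) (a⁻¹ • region (𝕋 n)) := by
    intro z hz
    rw [Metric.hausdorffEDist_comm] at hn
    obtain ⟨q, hq, hzq⟩ := Metric.exists_edist_lt_of_hausdorffEDist_lt
      (interior_subset (hball hz)) hn
    rw [edist_lt_ofReal] at hzq
    exact Metric.mem_thickening_iff.2 ⟨q, hq, hzq⟩
  have hsub := ball_sub_subset_of_subset_thickening
    ((isCompact_region (𝕋 n)).smul a⁻¹).isComplete ((convex_region (𝕋 n)).smul a⁻¹)
    (half_pos hr).le hthick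
  refine ⟨a • x₀, ?_⟩
  rwa [Set.subset_smul_set_iff₀ (inv_ne_zero ha.ne'), inv_inv, smul_ball ha.ne',
    Real.norm_of_nonneg ha.le] at hsub

theorem SamplingCondition.eventually_mul_lt_rpow_mul (hS : SamplingCondition 𝕋) {Δ : ℕ → ℝ}
    (hΔvol : Tendsto (fun n => Δ n ^ d / volume.real (region (𝕋 n))) atTop (𝓝 0)) (R : ℝ)
    {r : ℝ} (hr : 0 < r) :
    ∀ᶠ n in atTop, R * Δ n < volume.real (region (𝕋 n)) ^ (1 / (d : ℝ)) * r := by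
  have hscale := hΔvol.const_mul (R ^ d)
  rw [mul_zero] at hscale
  filter_upwards [hscale.eventually_lt_const (pow_pos hr d),
    hS.volume_tendsto.eventually_gt_atTop 0] with n hn hpos
  refine lt_of_pow_lt_pow_left₀ d (by positivity) ?_
  rwa [mul_pow, mul_pow, one_div, Real.rpow_inv_natCast_pow hpos.le hS.dim_ne_zero,
    ← div_lt_iff₀' hpos, mul_div_assoc]

theorem SamplingCondition.exists_mul_volume_le_volume_inter (hS : SamplingCondition 𝕋)
    {Δ : ℕ → ℝ}
    (hΔvol : Tendsto (fun n => Δ n ^ d / volume.real (region (𝕋 n))) atTop (𝓝 0)) (R : ℝ) :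
    ∃ c > (0 : ℝ), ∀ᶠ n in atTop, ∀ h : EuclideanSpace ℝ (Fin d), ‖h‖ ≤ R * Δ n →
      c * volume.real (region (𝕋 n)) ≤
        volume.real (region (𝕋 n) ∩ (fun x => x - h) '' region (𝕋 n)) := by
  obtain ⟨r, hr, hball⟩ := hS.exists_ball_subset_region
  refine ⟨(r / 2) ^ d * volume.real (Metric.ball (0 : EuclideanSpace ℝ (Fin d)) 1),
    mul_pos (by positivity)
      (ENNReal.toReal_pos (Metric.measure_ball_pos _ _ one_pos).ne' measure_ball_lt_top.ne), ?_⟩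
  filter_upwards [hball, hS.eventually_mul_lt_rpow_mul hΔvol R (half_pos hr),
    hS.volume_tendsto.eventually_gt_atTop 0] with n ⟨x, hx⟩ hlt hpos h hh
  set V := volume.real (region (𝕋 n))
  have hVd : (V ^ (1 / (d : ℝ))) ^ d = V := by
    rw [one_div, Real.rpow_inv_natCast_pow hpos.le hS.dim_ne_zero]
  calc (r / 2) ^ d * volume.real (Metric.ball (0 : EuclideanSpace ℝ (Fin d)) 1) * V
      = volume.real (Metric.ball x (V ^ (1 / (d : ℝ)) * (r / 2))) := by
        rw [measureReal_def, measureReal_def, Measure.addHaar_ball_of_pos _ x (by positivity),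
          finrank_euclideanSpace_fin, mul_pow, hVd, ENNReal.toReal_mul,
          ENNReal.toReal_ofReal (by positivity)]
        ring
    _ ≤ _ := by
        refine measureReal_mono ((Metric.ball_subset_ball ?_).trans
          (ball_sub_subset_inter_image_sub hx h))
          (measure_ne_top_of_subset Set.inter_subset_left (isCompact_region _).measure_ne_top)
        linarith

end Overlap

/-! ### Riemann sums over Voronoi cells -/

section LocalSup

/-- The local supremum of `f` over the closed ball of radius `δ`: an upper envelope whose integral
dominates the Riemann sums of `f` over cells of radius at most `δ`. -/
noncomputable def localSup {E : Type*} [PseudoMetricSpace E] (δ : ℝ) (f : E → ℝ≥0∞) (x : E) :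
    ℝ≥0∞ :=
  ⨆ y ∈ Metric.closedBall x δ, f y

theorem le_localSup {E : Type*} [PseudoMetricSpace E] {δ : ℝ} (f : E → ℝ≥0∞) {x y : E}
    (hxy : dist x y ≤ δ) : f y ≤ localSup δ f x :=
  le_iSup₂ (f := fun y (_ : y ∈ Metric.closedBall x δ) => f y) y
    (Metric.mem_closedBall'.2 hxy)

variable {d : ℕ} {𝕋 : Finset (EuclideanSpace ℝ (Fin d))} {δ : ℝ}

theorem sum_volume_cell_mul_sub_right_le (hδ : 0 ≤ δ) (hmesh : mesh 𝕋 ≤ ENNReal.ofReal δ)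
    (f : EuclideanSpace ℝ (Fin d) → ℝ≥0∞) (t : EuclideanSpace ℝ (Fin d)) :
    ∑ w ∈ 𝕋, volume (cell 𝕋 w) * f (w - t) ≤ ∫⁻ x, localSup δ f x := by
  rw [← lintegral_sub_right_eq_self _ t]
  refine sum_volume_cell_mul_le_lintegral 𝕋 fun w hw x hx => le_localSup f ?_
  rw [dist_sub_right, dist_eq_norm]
  exact norm_sub_le_of_mem_cell hδ hmesh hw hx

theorem sum_volume_cell_mul_sub_left_le (hδ : 0 ≤ δ) (hmesh : mesh 𝕋 ≤ ENNReal.ofReal δ)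
    (f : EuclideanSpace ℝ (Fin d) → ℝ≥0∞) (t : EuclideanSpace ℝ (Fin d)) :
    ∑ w ∈ 𝕋, volume (cell 𝕋 w) * f (t - w) ≤ ∫⁻ x, localSup δ f x := by
  rw [← lintegral_sub_left_eq_self _ t]
  refine sum_volume_cell_mul_le_lintegral 𝕋 fun w hw x hx => le_localSup f ?_
  rw [dist_sub_left, dist_eq_norm]
  exact norm_sub_le_of_mem_cell hδ hmesh hw hx

theorem sum_volume_cell_mul_indicator_closedBall_le (hδ : 0 ≤ δ)
    (hmesh : mesh 𝕋 ≤ ENNReal.ofReal δ) (t : EuclideanSpace ℝ (Fin d)) (r : ℝ) :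
    ∑ s ∈ 𝕋, volume (cell 𝕋 s) * (Metric.closedBall t r).indicator 1 s ≤
      volume (Metric.closedBall t (r + δ)) := by
  rw [← lintegral_indicator_one Metric.isClosed_closedBall.measurableSet]
  refine sum_volume_cell_mul_le_lintegral 𝕋 fun s hs x hx => ?_
  by_cases hst : s ∈ Metric.closedBall t r
  · have hxt : x ∈ Metric.closedBall t (r + δ) := by
      have hxs := norm_sub_le_of_mem_cell hδ hmesh hs hx
      rw [← dist_eq_norm] at hxs
      rw [Metric.mem_closedBall] at hst ⊢
      linarith [dist_triangle x s t]
    simp [hst, hxt]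
  · simp [hst]

end LocalSup

section Conditions

variable {Ω H ι : Type*} [MeasurableSpace Ω] {P : Measure Ω} [NormedAddCommGroup H]
  [InnerProductSpace ℂ H] [CompleteSpace H] {e : HilbertBasis ι ℂ H} {d : ℕ}

theorem CovarianceCondition.exists_lintegral_localSup_lt_top
    {C : EuclideanSpace ℝ (Fin d) → H →L[ℂ] H} (hC : CovarianceCondition e C) :
    ∃ δ > (0 : ℝ), ∫⁻ x, localSup δ (fun h => traceNorm e (C h)) x < ∞ := by
  obtain ⟨γ, -, -, M, δ, hδ, hholder⟩ := hC.holder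
  have hosc (x y : EuclideanSpace ℝ (Fin d)) (hy : y ∈ Metric.closedBall x δ) :
      traceNorm e (C y) ≤
        traceNorm e (C x) + ⨆ y, ⨆ (_ : ‖x - y‖ ≤ δ), traceNorm e (C y - C x) := by
    rw [Metric.mem_closedBall', dist_eq_norm] at hy
    calc traceNorm e (C y) = traceNorm e (C x + (C y - C x)) := by rw [add_sub_cancel]
      _ ≤ traceNorm e (C x) + traceNorm e (C y - C x) := traceNorm_add_le e _ _
      _ ≤ _ := by
        gcongr
        exact le_iSup₂_of_le y hy le_rfl
  refine ⟨δ, hδ, (lintegral_mono fun x => iSup₂_le (hosc x)).trans_lt ?_⟩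
  rw [lintegral_add_left' hC.aemeasurable]
  exact ENNReal.add_lt_top.2 ⟨hC.integrable,
    (hholder δ hδ le_rfl).trans_lt ENNReal.ofReal_lt_top⟩

variable {X : EuclideanSpace ℝ (Fin d) → Ω → H}

theorem sum_sum_volume_cell_mul_enorm_cum_le {𝕋 : Finset (EuclideanSpace ℝ (Fin d))} {δ : ℝ}
    (hshift : ∀ t s w v τ, cum P e (X (t + τ)) (X (s + τ)) (X (w + τ)) (X (v + τ)) =
      cum P e (X t) (X s) (X w) (X v)) (hδ : 0 < δ) (hmesh : mesh 𝕋 ≤ ENNReal.ofReal (δ / 2))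
    (w v : EuclideanSpace ℝ (Fin d)) :
    ∑ t ∈ 𝕋, ∑ s ∈ 𝕋, volume (cell 𝕋 t) * volume (cell 𝕋 s) *
      ‖cum P e (X t) (X s) (X w) (X v)‖ₑ ≤
    ∫⁻ x, ∫⁻ y,
      ⨆ l₁ ∈ Metric.ball (0 : EuclideanSpace ℝ (Fin d)) δ,
      ⨆ l₂ ∈ Metric.ball (0 : EuclideanSpace ℝ (Fin d)) δ,
      ⨆ l₃ ∈ Metric.ball (0 : EuclideanSpace ℝ (Fin d)) δ,
        ‖cum P e (X (l₁ + x)) (X (l₂ + y)) (X (l₃ + (w - v))) (X 0)‖ₑ := by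
  set F : EuclideanSpace ℝ (Fin d) → EuclideanSpace ℝ (Fin d) → ℝ≥0∞ := fun x y =>
    ⨆ l₁ ∈ Metric.ball (0 : EuclideanSpace ℝ (Fin d)) δ,
    ⨆ l₂ ∈ Metric.ball (0 : EuclideanSpace ℝ (Fin d)) δ,
    ⨆ l₃ ∈ Metric.ball (0 : EuclideanSpace ℝ (Fin d)) δ,
      ‖cum P e (X (l₁ + x)) (X (l₂ + y)) (X (l₃ + (w - v))) (X 0)‖ₑ
  have hball : ∀ t ∈ 𝕋, ∀ x ∈ cell 𝕋 t, t - x ∈ Metric.ball 0 δ := fun t ht x hx => by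
    rw [mem_ball_zero_iff, norm_sub_rev]
    linarith [norm_sub_le_of_mem_cell (half_pos hδ).le hmesh ht hx]
  have hle : ∀ t ∈ 𝕋, ∀ x ∈ cell 𝕋 t, ∀ s ∈ 𝕋, ∀ y ∈ cell 𝕋 s,
      ‖cum P e (X t) (X s) (X w) (X v)‖ₑ ≤ F (x - v) (y - v) := by
    intro t ht x hx s hs y hy
    refine le_iSup₂_of_le (t - x) (hball t ht x hx) (le_iSup₂_of_le (s - y) (hball s hs y hy)
      (le_iSup₂_of_le 0 (Metric.mem_ball_self hδ) (le_of_eq ?_)))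
    have hcum := hshift (t - v) (s - v) (w - v) 0 v
    simp only [sub_add_cancel, zero_add] at hcum
    simp only [sub_add_sub_cancel, zero_add, hcum]
  calc ∑ t ∈ 𝕋, ∑ s ∈ 𝕋, volume (cell 𝕋 t) * volume (cell 𝕋 s) *
          ‖cum P e (X t) (X s) (X w) (X v)‖ₑ
      = ∑ t ∈ 𝕋, volume (cell 𝕋 t) *
          ∑ s ∈ 𝕋, volume (cell 𝕋 s) * ‖cum P e (X t) (X s) (X w) (X v)‖ₑ := by
        simp only [Finset.mul_sum, mul_assoc]
    _ ≤ ∫⁻ x, ∫⁻ y, F (x - v) (y - v) :=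
        sum_volume_cell_mul_le_lintegral 𝕋 fun t ht x hx =>
          sum_volume_cell_mul_le_lintegral 𝕋 fun s hs y hy => hle t ht x hx s hs y hy
    _ = ∫⁻ x, ∫⁻ y, F (x - v) y :=
        lintegral_congr fun x => lintegral_sub_right_eq_self (F (x - v)) v
    _ = ∫⁻ x, ∫⁻ y, F x y := lintegral_sub_right_eq_self (fun x => ∫⁻ y, F x y) v

theorem CumulantCondition.exists_sum_le (hV : CumulantCondition P e X) :
    ∃ J : ℝ≥0∞, J < ∞ ∧ ∃ δ > (0 : ℝ), ∀ 𝕋 : Finset (EuclideanSpace ℝ (Fin d)),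
      mesh 𝕋 ≤ ENNReal.ofReal δ → ∀ w v,
        ∑ t ∈ 𝕋, ∑ s ∈ 𝕋, volume (cell 𝕋 t) * volume (cell 𝕋 s) *
          ‖cum P e (X t) (X s) (X w) (X v)‖ₑ ≤ J := by
  obtain ⟨δ, hδ, hJ⟩ := hV.cum_integrable
  exact ⟨_, hJ, δ / 2, half_pos hδ, fun 𝕋 hmesh w v =>
    (sum_sum_volume_cell_mul_enorm_cum_le hV.cum_shift hδ hmesh w v).trans
      (le_iSup_of_le (w - v) le_rfl)⟩

end Conditions

section CovarianceSums

variable {Ω H ι : Type*} [MeasurableSpace Ω] {P : Measure Ω} [NormedAddCommGroup H]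
  [InnerProductSpace ℂ H] [CompleteSpace H] {e : HilbertBasis ι ℂ H} {d : ℕ}
  {X : EuclideanSpace ℝ (Fin d) → Ω → H}

theorem sum_sum_volume_cell_mul_enorm_hsCov_outer_le [Countable ι]
    (hreal : IsRealProcess P e X) (hstat : IsSecondOrderStationary P e X)
    {𝕋 : Finset (EuclideanSpace ℝ (Fin d))} {δ : ℝ} (hδ : 0 ≤ δ)
    (hmesh : mesh 𝕋 ≤ ENNReal.ofReal δ) {I J : ℝ≥0∞}
    (hI : ∫⁻ x, localSup δ (fun h => traceNorm e (statCov P X h)) x ≤ I)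
    {w v : EuclideanSpace ℝ (Fin d)}
    (hJ : ∑ t ∈ 𝕋, ∑ s ∈ 𝕋, volume (cell 𝕋 t) * volume (cell 𝕋 s) *
      ‖cum P e (X t) (X s) (X w) (X v)‖ₑ ≤ J) :
    ∑ t ∈ 𝕋, ∑ s ∈ 𝕋, volume (cell 𝕋 t) * volume (cell 𝕋 s) *
      ‖hsCov P e (fun ω => outer (X t ω) (X s ω)) (fun ω => outer (X w ω) (X v ω))‖ₑ ≤
      J + 2 * I ^ 2 := by
  set m := fun t => volume (cell 𝕋 t)
  set ρ := fun h => traceNorm e (statCov P X h)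
  have hright (p) : ∑ t ∈ 𝕋, m t * ρ (t - p) ≤ I :=
    (sum_volume_cell_mul_sub_right_le hδ hmesh ρ p).trans hI
  have hleft (p) : ∑ t ∈ 𝕋, m t * ρ (p - t) ≤ I :=
    (sum_volume_cell_mul_sub_left_le hδ hmesh ρ p).trans hI
  calc ∑ t ∈ 𝕋, ∑ s ∈ 𝕋, m t * m s *
        ‖hsCov P e (fun ω => outer (X t ω) (X s ω)) (fun ω => outer (X w ω) (X v ω))‖ₑ
      ≤ ∑ t ∈ 𝕋, ∑ s ∈ 𝕋, m t * m s * (‖cum P e (X t) (X s) (X w) (X v)‖ₑ +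
          ρ (w - t) * ρ (s - v) + ρ (t - v) * ρ (w - s)) := by
        gcongr with t _ s _
        exact enorm_hsCov_outer_le hreal hstat t s w v
    _ = (∑ t ∈ 𝕋, ∑ s ∈ 𝕋, m t * m s * ‖cum P e (X t) (X s) (X w) (X v)‖ₑ) +
          (∑ t ∈ 𝕋, m t * ρ (w - t)) * (∑ s ∈ 𝕋, m s * ρ (s - v)) +
          (∑ t ∈ 𝕋, m t * ρ (t - v)) * (∑ s ∈ 𝕋, m s * ρ (w - s)) := by
        simp only [Finset.sum_mul_sum, ← Finset.sum_add_distrib]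
        refine Finset.sum_congr rfl fun t _ => Finset.sum_congr rfl fun s _ => ?_
        ring
    _ ≤ J + I * I + I * I := by
        gcongr
        exacts [hleft w, hright v, hright v, hleft w]
    _ = J + 2 * I ^ 2 := by ring

end CovarianceSums

/-! ### The estimator -/

section Coefficients

variable {d : ℕ} {K : EuclideanSpace ℝ (Fin d) → ℝ} {𝕋 : Finset (EuclideanSpace ℝ (Fin d))}

/-- The scalar coefficient of `X t ⊗ X s` in `estimator X K 𝕋 Δ θ`. -/
noncomputable def estimatorCoeff (K : EuclideanSpace ℝ (Fin d) → ℝ)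
    (𝕋 : Finset (EuclideanSpace ℝ (Fin d))) (Δ : ℝ) (θ t s : EuclideanSpace ℝ (Fin d)) : ℂ :=
  ((1 / (2 * Real.pi) ^ d : ℝ) : ℂ) *
    (Complex.exp (Complex.I * ((inner ℝ (t - s) θ : ℝ) : ℂ)) *
      ((K (Δ⁻¹ • (t - s)) * volume.real (cell 𝕋 t) * volume.real (cell 𝕋 s) /
        volume.real (region 𝕋 ∩ (fun x => x - (t - s)) '' region 𝕋) : ℝ) : ℂ))

theorem estimator_eq_sum {Ω H : Type*} [NormedAddCommGroup H] [InnerProductSpace ℂ H]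
    (X : EuclideanSpace ℝ (Fin d) → Ω → H) (K : EuclideanSpace ℝ (Fin d) → ℝ)
    (𝕋 : Finset (EuclideanSpace ℝ (Fin d))) (Δ : ℝ) (θ : EuclideanSpace ℝ (Fin d)) (ω : Ω) :
    estimator X K 𝕋 Δ θ ω =
      ∑ p ∈ 𝕋 ×ˢ 𝕋, estimatorCoeff K 𝕋 Δ θ p.1 p.2 • outer (X p.1 ω) (X p.2 ω) := by
  simp only [estimator, estimatorCoeff, Finset.sum_product, Finset.smul_sum, smul_smul]

theorem norm_estimatorCoeff_le (K : EuclideanSpace ℝ (Fin d) → ℝ)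
    (𝕋 : Finset (EuclideanSpace ℝ (Fin d))) (Δ : ℝ) (θ t s : EuclideanSpace ℝ (Fin d)) :
    ‖estimatorCoeff K 𝕋 Δ θ t s‖ ≤
      |K (Δ⁻¹ • (t - s))| * (volume.real (cell 𝕋 t) * volume.real (cell 𝕋 s)) /
        volume.real (region 𝕋 ∩ (fun x => x - (t - s)) '' region 𝕋) := by
  have hpi : ‖((1 / (2 * Real.pi) ^ d : ℝ) : ℂ)‖ ≤ 1 := by
    rw [Complex.norm_real, Real.norm_of_nonneg (by positivity)]
    refine div_le_one_of_le₀ (one_le_pow₀ ?_) (by positivity)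
    linarith [Real.pi_gt_three]
  have hexp : ‖Complex.exp (Complex.I * ((inner ℝ (t - s) θ : ℝ) : ℂ))‖ = 1 := by
    rw [mul_comm, Complex.norm_exp_ofReal_mul_I]
  rw [estimatorCoeff, norm_mul, norm_mul, hexp, one_mul]
  refine (mul_le_of_le_one_left (norm_nonneg _) hpi).trans_eq ?_
  rw [Complex.norm_real, Real.norm_eq_abs, mul_assoc, abs_div, abs_mul,
    abs_of_nonneg (by positivity : 0 ≤ volume.real (cell 𝕋 t) * volume.real (cell 𝕋 s)),
    abs_of_nonneg measureReal_nonneg]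

theorem enorm_estimatorCoeff_le {B R Δ b : ℝ} (hB : ∀ u, |K u| ≤ B)
    (hR : Function.support K ⊆ Metric.closedBall 0 R) (hΔ : 0 < Δ) (hb : 0 < b)
    (hinter : ∀ h : EuclideanSpace ℝ (Fin d), ‖h‖ ≤ R * Δ →
      b ≤ volume.real (region 𝕋 ∩ (fun x => x - h) '' region 𝕋))
    (θ t s : EuclideanSpace ℝ (Fin d)) :
    ‖estimatorCoeff K 𝕋 Δ θ t s‖ₑ ≤ ENNReal.ofReal (B / b) *
      (volume (cell 𝕋 t) * volume (cell 𝕋 s) *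
        (Metric.closedBall t (R * Δ)).indicator 1 s) := by
  by_cases hst : s ∈ Metric.closedBall t (R * Δ)
  · have hB0 : 0 ≤ B := (abs_nonneg _).trans (hB 0)
    have hlag : ‖t - s‖ ≤ R * Δ := by rwa [Metric.mem_closedBall', dist_eq_norm] at hst
    have hnorm : ‖estimatorCoeff K 𝕋 Δ θ t s‖ ≤
        B / b * (volume.real (cell 𝕋 t) * volume.real (cell 𝕋 s)) := by
      refine (norm_estimatorCoeff_le K 𝕋 Δ θ t s).trans ?_
      rw [div_mul_eq_mul_div]
      gcongr
      exacts [hB _, hinter _ hlag]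
    rw [Set.indicator_of_mem hst, Pi.one_apply, mul_one, ← ofReal_norm,
      ← ofReal_measureReal (volume_cell_ne_top 𝕋 t), ← ofReal_measureReal (volume_cell_ne_top 𝕋 s),
      ← ENNReal.ofReal_mul measureReal_nonneg, ← ENNReal.ofReal_mul (by positivity)]
    exact ENNReal.ofReal_le_ofReal hnorm
  · have hK : K (Δ⁻¹ • (t - s)) = 0 := by
      by_contra hne
      have hball := hR hne
      rw [mem_closedBall_zero_iff, norm_smul, norm_inv, Real.norm_of_nonneg hΔ.le,
        inv_mul_le_iff₀ hΔ, mul_comm] at hball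
      exact hst (by rwa [Metric.mem_closedBall', dist_eq_norm])
    simp [estimatorCoeff, hK]

theorem sum_sum_volume_cell_mul_indicator_closedBall_le {δ : ℝ} (hδ : 0 ≤ δ)
    (hmesh : mesh 𝕋 ≤ ENNReal.ofReal δ) (r : ℝ) :
    ∑ t ∈ 𝕋, ∑ s ∈ 𝕋, volume (cell 𝕋 t) * volume (cell 𝕋 s) *
        (Metric.closedBall t r).indicator 1 s ≤
      volume (region 𝕋) * volume (Metric.closedBall (0 : EuclideanSpace ℝ (Fin d)) (r + δ)) := by
  simp only [mul_assoc, ← Finset.mul_sum]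
  calc ∑ t ∈ 𝕋, volume (cell 𝕋 t) *
        ∑ s ∈ 𝕋, volume (cell 𝕋 s) * (Metric.closedBall t r).indicator 1 s
      ≤ ∑ t ∈ 𝕋, volume (cell 𝕋 t) * volume (Metric.closedBall t (r + δ)) := by
        gcongr with t _
        exact sum_volume_cell_mul_indicator_closedBall_le hδ hmesh t r
    _ = (∑ t ∈ 𝕋, volume (cell 𝕋 t)) *
          volume (Metric.closedBall (0 : EuclideanSpace ℝ (Fin d)) (r + δ)) := by
        simp only [Measure.addHaar_closedBall_center, Finset.sum_mul]
    _ ≤ _ := by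
        gcongr
        exact sum_volume_cell_le 𝕋

end Coefficients

section Variance

variable {Ω H ι : Type*} [MeasurableSpace Ω] {P : Measure Ω} [IsProbabilityMeasure P]
  [NormedAddCommGroup H] [InnerProductSpace ℂ H] [CompleteSpace H] [Countable ι]
  {e : HilbertBasis ι ℂ H} {d : ℕ} {X : EuclideanSpace ℝ (Fin d) → Ω → H}
  {K : EuclideanSpace ℝ (Fin d) → ℝ} {𝕋 : Finset (EuclideanSpace ℝ (Fin d))}

theorem estimatorVariance_le_sum (hX : ∀ t, MemLp (X t) 4 P) (Δ : ℝ)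
    (θ : EuclideanSpace ℝ (Fin d)) :
    estimatorVariance P e X K 𝕋 Δ θ ≤ ∑ q ∈ 𝕋 ×ˢ 𝕋, ‖estimatorCoeff K 𝕋 Δ θ q.1 q.2‖ₑ *
      ∑ p ∈ 𝕋 ×ˢ 𝕋, ‖estimatorCoeff K 𝕋 Δ θ p.1 p.2‖ₑ *
        ‖hsCov P e (fun ω => outer (X p.1 ω) (X p.2 ω))
          (fun ω => outer (X q.1 ω) (X q.2 ω))‖ₑ := by
  simp only [estimatorVariance, hsNorm_sq, estimator_eq_sum]
  refine (lintegral_hsSq_sum_sub_integral_le (𝕋 ×ˢ 𝕋) _ fun p _ =>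
    isHSSquareIntegrable_outer e (hX p.1) (hX p.2)).trans_eq ?_
  rw [Finset.sum_comm]
  simp only [Finset.mul_sum]
  exact Finset.sum_congr rfl fun q _ => Finset.sum_congr rfl fun p _ => by ring

theorem estimatorVariance_le {B R Δ b δ : ℝ} {Q : ℝ≥0∞} (hX : ∀ t, MemLp (X t) 4 P)
    (hB : ∀ u, |K u| ≤ B) (hR : Function.support K ⊆ Metric.closedBall 0 R) (hΔ : 0 < Δ)
    (hb : 0 < b)
    (hinter : ∀ h : EuclideanSpace ℝ (Fin d), ‖h‖ ≤ R * Δ →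
      b ≤ volume.real (region 𝕋 ∩ (fun x => x - h) '' region 𝕋))
    (hδ : 0 ≤ δ) (hmesh : mesh 𝕋 ≤ ENNReal.ofReal δ)
    (hQ : ∀ w v, ∑ t ∈ 𝕋, ∑ s ∈ 𝕋, volume (cell 𝕋 t) * volume (cell 𝕋 s) *
      ‖hsCov P e (fun ω => outer (X t ω) (X s ω)) (fun ω => outer (X w ω) (X v ω))‖ₑ ≤ Q)
    (θ : EuclideanSpace ℝ (Fin d)) :
    estimatorVariance P e X K 𝕋 Δ θ ≤ ENNReal.ofReal (B / b) ^ 2 *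
      (volume (region 𝕋) * volume (Metric.closedBall (0 : EuclideanSpace ℝ (Fin d)) (R * Δ + δ))) *
        Q := by
  set κ := ENNReal.ofReal (B / b)
  set a := fun p : EuclideanSpace ℝ (Fin d) × EuclideanSpace ℝ (Fin d) =>
    estimatorCoeff K 𝕋 Δ θ p.1 p.2
  have hcoeff (p) : ‖a p‖ₑ ≤ κ * (volume (cell 𝕋 p.1) * volume (cell 𝕋 p.2) *
      (Metric.closedBall p.1 (R * Δ)).indicator 1 p.2) :=
    enorm_estimatorCoeff_le hB hR hΔ hb hinter θ p.1 p.2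
  have hcoeff' (p) : ‖a p‖ₑ ≤ κ * (volume (cell 𝕋 p.1) * volume (cell 𝕋 p.2)) :=
    (hcoeff p).trans (mul_le_mul_right
      (mul_le_of_le_one_right' (Set.indicator_le_self (M := ℝ≥0∞) _ 1 p.2)) κ)
  have hinner (q : EuclideanSpace ℝ (Fin d) × EuclideanSpace ℝ (Fin d)) :
      ∑ p ∈ 𝕋 ×ˢ 𝕋, ‖a p‖ₑ * ‖hsCov P e (fun ω => outer (X p.1 ω) (X p.2 ω))
        (fun ω => outer (X q.1 ω) (X q.2 ω))‖ₑ ≤ κ * Q :=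
    calc _ ≤ ∑ p ∈ 𝕋 ×ˢ 𝕋, κ * (volume (cell 𝕋 p.1) * volume (cell 𝕋 p.2)) *
          ‖hsCov P e (fun ω => outer (X p.1 ω) (X p.2 ω))
            (fun ω => outer (X q.1 ω) (X q.2 ω))‖ₑ := by
          gcongr with p _
          exact hcoeff' p
      _ ≤ κ * Q := by
          simp only [mul_assoc κ, ← Finset.mul_sum, Finset.sum_product]
          gcongr
          exact hQ q.1 q.2
  calc estimatorVariance P e X K 𝕋 Δ θ ≤ ∑ q ∈ 𝕋 ×ˢ 𝕋, ‖a q‖ₑ * (κ * Q) := by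
        refine (estimatorVariance_le_sum hX Δ θ).trans ?_
        gcongr with q _
        exact hinner q
    _ ≤ (∑ q ∈ 𝕋 ×ˢ 𝕋, κ * (volume (cell 𝕋 q.1) * volume (cell 𝕋 q.2) *
          (Metric.closedBall q.1 (R * Δ)).indicator 1 q.2)) * (κ * Q) := by
        rw [← Finset.sum_mul]
        gcongr with q _
        exact hcoeff q
    _ ≤ κ * (volume (region 𝕋) *
          volume (Metric.closedBall (0 : EuclideanSpace ℝ (Fin d)) (R * Δ + δ))) * (κ * Q) := by
        rw [← Finset.mul_sum, Finset.sum_product]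
        refine mul_le_mul_left (mul_le_mul_right ?_ _) _
        exact sum_sum_volume_cell_mul_indicator_closedBall_le hδ hmesh (R * Δ)
    _ = _ := by ring

theorem estimatorVariance_le_ofReal {B R Δ b c : ℝ} {Q : ℝ≥0∞} (hX : ∀ t, MemLp (X t) 4 P)
    (hB : ∀ u, |K u| ≤ B) (hR₀ : 0 ≤ R) (hR : Function.support K ⊆ Metric.closedBall 0 R)
    (hΔ : 0 < Δ) (hb : 0 < b) (hvol : 0 < volume.real (region 𝕋))
    (hinter : ∀ h : EuclideanSpace ℝ (Fin d), ‖h‖ ≤ R * Δ → b * volume.real (region 𝕋) ≤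
      volume.real (region 𝕋 ∩ (fun x => x - h) '' region 𝕋))
    (hc : 0 ≤ c) (hmesh : mesh 𝕋 ≤ ENNReal.ofReal (c * Δ)) (hQ_top : Q ≠ ∞)
    (hQ : ∀ w v, ∑ t ∈ 𝕋, ∑ s ∈ 𝕋, volume (cell 𝕋 t) * volume (cell 𝕋 s) *
      ‖hsCov P e (fun ω => outer (X t ω) (X s ω)) (fun ω => outer (X w ω) (X v ω))‖ₑ ≤ Q)
    (θ : EuclideanSpace ℝ (Fin d)) :
    estimatorVariance P e X K 𝕋 Δ θ ≤ ENNReal.ofReal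
      ((B / b) ^ 2 * ((R + c) ^ d *
        volume.real (Metric.ball (0 : EuclideanSpace ℝ (Fin d)) 1)) * Q.toReal *
          (Δ ^ d / volume.real (region 𝕋))) := by
  have hB₀ : 0 ≤ B := (abs_nonneg _).trans (hB 0)
  have hball : volume (Metric.closedBall (0 : EuclideanSpace ℝ (Fin d)) (R * Δ + c * Δ)) =
      ENNReal.ofReal (((R + c) * Δ) ^ d *
        volume.real (Metric.ball (0 : EuclideanSpace ℝ (Fin d)) 1)) := by
    rw [← add_mul, Measure.addHaar_closedBall _ _ (by positivity), finrank_euclideanSpace_fin,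
      ENNReal.ofReal_mul (by positivity), ofReal_measureReal measure_ball_lt_top.ne]
  refine (estimatorVariance_le hX hB hR hΔ (mul_pos hb hvol) hinter (by positivity) hmesh hQ
    θ).trans_eq ?_
  rw [hball, ← ofReal_measureReal (isCompact_region 𝕋).measure_ne_top,
    ← ENNReal.ofReal_toReal hQ_top, ← ENNReal.ofReal_pow (by positivity),
    ← ENNReal.ofReal_mul (by positivity), ← ENNReal.ofReal_mul (by positivity),
    ← ENNReal.ofReal_mul (by positivity), ENNReal.toReal_ofReal ENNReal.toReal_nonneg, mul_pow]
  congr 1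
  field_simp

end Variance

section KernelCondition

variable {d : ℕ} {K : EuclideanSpace ℝ (Fin d) → ℝ}

theorem KernelCondition.abs_le_one (hK : KernelCondition K) (u : EuclideanSpace ℝ (Fin d)) :
    |K u| ≤ 1 :=
  (abs_of_nonneg (hK.nonneg u)).trans_le (hK.le_one u)

theorem KernelCondition.isBounded_support (hK : KernelCondition K) :
    Bornology.IsBounded (Function.support K) :=
  hK.support_bounded.subset fun u hu => (hK.nonneg u).lt_of_ne' hu

end KernelCondition

end SpectralVar

open SpectralVar in
theorem mainTheorem6_general {Ω H ι : Type*} [MeasurableSpace Ω] (P : Measure Ω)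
    [IsProbabilityMeasure P] [NormedAddCommGroup H] [InnerProductSpace ℂ H] [CompleteSpace H]
    [TopologicalSpace.SeparableSpace H] (e : HilbertBasis ι ℂ H) {d : ℕ}
    (X : EuclideanSpace ℝ (Fin d) → Ω → H)
    (hreal : IsRealProcess P e X) (hstat : IsSecondOrderStationary P e X)
    (hC : ∃ δ > (0 : ℝ), ∫⁻ x, localSup δ (fun h => traceNorm e (statCov P X h)) x < ∞)
    (K : EuclideanSpace ℝ (Fin d) → ℝ) (hK : ∃ B, ∀ u, |K u| ≤ B)
    (hKsupp : Bornology.IsBounded (Function.support K))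
    (𝕋 : ℕ → Finset (EuclideanSpace ℝ (Fin d))) (hS : SamplingCondition 𝕋)
    (hV : CumulantCondition P e X) (Δ : ℕ → ℝ) (hΔpos : ∀ n, 0 < Δ n)
    (hΔmesh : ∃ c : ℝ, ∀ᶠ n in atTop, mesh (𝕋 n) ≤ ENNReal.ofReal (c * Δ n))
    (hΔvol : Tendsto (fun n => Δ n ^ d / volume.real (region (𝕋 n))) atTop (𝓝 0)) :
    ∃ M : ℝ, ∀ᶠ n in atTop, ∀ θ, estimatorVariance P e X K (𝕋 n) (Δ n) θ ≤
      ENNReal.ofReal (M * (Δ n ^ d / volume.real (region (𝕋 n)))) := by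
  have : Countable ι := countable_of_hilbertBasis e
  obtain ⟨c, hc⟩ := hΔmesh
  obtain ⟨B, hB⟩ := hK
  obtain ⟨R, hR₀, hR⟩ := hKsupp.subset_closedBall_lt 0 0
  obtain ⟨δ₁, hδ₁, hI⟩ := hC
  obtain ⟨J, hJ, δ₂, hδ₂, hcum⟩ := hV.exists_sum_le
  obtain ⟨b, hb, hinter⟩ := hS.exists_mul_volume_le_volume_inter hΔvol R
  set I := ∫⁻ x, localSup δ₁ (fun h => traceNorm e (statCov P X h)) x
  refine ⟨(B / b) ^ 2 * ((R + max c 0) ^ d *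
    volume.real (Metric.ball (0 : EuclideanSpace ℝ (Fin d)) 1)) * (J + 2 * I ^ 2).toReal, ?_⟩
  filter_upwards [hc, hinter, hS.volume_tendsto.eventually_gt_atTop 0,
    hS.mesh_tendsto.eventually_le_const (ENNReal.ofReal_pos.2 hδ₁),
    hS.mesh_tendsto.eventually_le_const (ENNReal.ofReal_pos.2 hδ₂)]
    with n hmesh hbn hvol hmesh₁ hmesh₂ θ
  have hmesh_max : mesh (𝕋 n) ≤ ENNReal.ofReal (max c 0 * Δ n) :=
    hmesh.trans (ENNReal.ofReal_le_ofReal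
      (mul_le_mul_of_nonneg_right (le_max_left c 0) (hΔpos n).le))
  exact estimatorVariance_le_ofReal hV.memLp_four hB hR₀.le hR (hΔpos n) hb hvol hbn
    (le_max_right c 0) hmesh_max (by finiteness)
    (fun w v => sum_sum_volume_cell_mul_enorm_hsCov_outer_le hreal hstat hδ₁.le hmesh₁ le_rfl
      (hcum _ hmesh₂ w v)) θ

theorem mainTheorem6 {Ω H ι : Type*} [MeasurableSpace Ω] (P : Measure Ω) [IsProbabilityMeasure P]
    [NormedAddCommGroup H] [InnerProductSpace ℂ H] [CompleteSpace H]
    [TopologicalSpace.SeparableSpace H] (e : HilbertBasis ι ℂ H) {d : ℕ}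
    (X : EuclideanSpace ℝ (Fin d) → Ω → H)
    (hreal : SpectralVar.IsRealProcess P e X)
    (hstat : SpectralVar.IsSecondOrderStationary P e X)
    (hC : SpectralVar.CovarianceCondition e (SpectralVar.statCov P X))
    (K : EuclideanSpace ℝ (Fin d) → ℝ) (hK : SpectralVar.KernelCondition K)
    (𝕋 : ℕ → Finset (EuclideanSpace ℝ (Fin d))) (hS : SpectralVar.SamplingCondition 𝕋)
    (hV : SpectralVar.CumulantCondition P e X)
    (Δ : ℕ → ℝ) (hΔpos : ∀ n, 0 < Δ n)
    (hΔmesh : ∃ c : ℝ, ∀ᶠ n in atTop, SpectralVar.mesh (𝕋 n) ≤ ENNReal.ofReal (c * Δ n))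
    (hΔsub : ∀ᶠ n in atTop, Δ n • SpectralVar.kernelSupport K ⊆
      SpectralVar.region (𝕋 n) - SpectralVar.region (𝕋 n))
    (hΔvol : Tendsto (fun n => Δ n ^ d / volume.real (SpectralVar.region (𝕋 n))) atTop (𝓝 0))
    (Θ : Set (EuclideanSpace ℝ (Fin d))) :
    ∃ M : ℝ, ∀ᶠ n in atTop,
      (⨆ θ ∈ Θ, SpectralVar.estimatorVariance P e X K (𝕋 n) (Δ n) θ) ≤
        ENNReal.ofReal (M * (Δ n ^ d / volume.real (SpectralVar.region (𝕋 n)))) := by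
  obtain ⟨M, hM⟩ := mainTheorem6_general P e X hreal hstat hC.exists_lintegral_localSup_lt_top K
    ⟨1, hK.abs_le_one⟩ hK.isBounded_support 𝕋 hS hV Δ hΔpos hΔmesh hΔvol
  exact ⟨M, hM.mono fun n hn => iSup₂_le fun θ _ => hn θ⟩
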